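/- Let $G$ be an abelian group (written multiplicatively, with unit $e$). Algebras are not assumed associative or unital. A $G$-graded algebra is graded simple if its product is not identically zero and it has no homogeneous two-sided ideals other than $0$ and itself. For an $\mathbb F$-algebra $A$, the multiplication algebra $M(A)$ is the subalgebra of $\operatorname{End}_{\mathbb F}A$ generated by all left and right multiplications by elements of $A$ (no identity is adjoined). If $A$ is $G$-graded, $\Gamma(A)_e$ denotes the algebra of all endomorphisms of the $M(A)$-module $A$ that map each component $A_g$ into itself (the neutral component of the graded centroid), and $Z(M(A))_e$ denotes the set of elements of the center of $M(A)$ that map each $A_g$ into itself. Let $\mathcal U=\bigoplus_{g\in G}\mathcal U_g$ be a $G$-graded, graded simple algebra which is finite-dimensional over the field $\mathbb F=\Gamma(\mathcal U)_e$, and for each $g$ let $\{u^g_1,\dots,u^g_{n_g}\}$ be an $\mathbb F$-basis of $\mathcal U_g$. Let $\widetilde{\mathbb F}$ be an extension field of the field of fractions of the polynomial ring $\mathbb F[t^g_{ij} : g\in G,\ 1\le i,j\le n_g]$. Let $\widetilde{\mathcal U}=\widetilde{\mathbb F}\otimes_{\mathbb F}\mathcal U$, graded by $\widetilde{\mathcal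 U}_g=\widetilde{\mathbb F}\otimes_{\mathbb F}\mathcal U_g$, and let $\mathcal F_{\mathcal U}$ be the $\mathbb F$-subalgebra of $\widetilde{\mathcal U}$ generated by the generic elements $y^g_i=\sum_{j=1}^{n_g}t^g_{ij}\otimes u^g_j$, with the induced grading. Put $Z_{\mathcal U}=Z(M(\mathcal F_{\mathcal U}))_e$ and $S=Z_{\mathcal U}\setminus\{0\}$, and let $S^{-1}\mathcal F_{\mathcal U}$ be the localization, with product $(a/s)(b/t)=ab/(st)$ and with component of degree $g$ consisting of the fractions $a/s$ with $a\in(\mathcal F_{\mathcal U})_g$. Then: (i) There is an injective homomorphism of $\mathbb F$-algebras $\iota: Z_{\mathcal U}\to\widetilde{\mathbb F}$ such that $z(y)=\iota(z)\,y$ in $\widetilde{\mathcal U}$ for all $z\in Z_{\mathcal U}$, $y\in\mathcal F_{\mathcal U}$. (ii) $S^{-1}\mathcal F_{\mathcal U}$ is a graded simple algebra, and $M(S^{-1}\mathcal F_{\mathcal U})$ satisfies an ordinary polynomial identity, i.e. some nonzero polynomial in the free associative algebra over $\mathbb F$ in countably many variables vanishes on it. (iii) $K_{\mathcal U}=\Gamma(S^{-1}\mathcal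 F_{\mathcal U})_e$ is a field, and it is the field of fractions of $Z_{\mathcal U}$: the map $\tau:Z_{\mathcal U}\to K_{\mathcal U}$, $\tau(z)(a/s)=z(a)/s$, is an injective homomorphism of $\mathbb F$-algebras, and every element of $K_{\mathcal U}$ has the form $\tau(s)^{-1}\tau(z)$ with $z\in Z_{\mathcal U}$, $s\in S$. (iv) There are an $\mathbb F$-algebra homomorphism $\kappa:K_{\mathcal U}\to\widetilde{\mathbb F}$ with $\kappa\circ\tau=\iota$ and an $\mathbb F$-linear map $j:S^{-1}\mathcal F_{\mathcal U}\to\widetilde{\mathcal U}$ with $j(a/s)=\iota(s)^{-1}a$ for $a\in\mathcal F_{\mathcal U}$, $s\in S$; and, regarding $\widetilde{\mathbb F}$ as an extension of $K_{\mathcal U}$ through $\kappa$, the map $$\widetilde{\mathbb F}\otimes_{K_{\mathcal U}}S^{-1}\mathcal F_{\mathcal U}\to\widetilde{\mathcal U},\qquad \lambda\otimes x\mapsto\lambda\,j(x),$$ is a well-defined isomorphism of $G$-graded $\widetilde{\mathbb F}$-algebras. -/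

import Mathlib

open scoped TensorProduct IsMulCommutative

noncomputable section

/-! ### Localization of a (nonassociative, nonunital) algebra at a set of scalars -/

section AlgLocalization

/-- The localization `S⁻¹A` of a not necessarily associative or unital algebra `A` over a
commutative ring `R` at a submonoid `S` of `R`. As a module it is the usual localization; the
product is `(a / s) * (b / t) = (a * b) / (s * t)`. -/
def AlgLocalization {R : Type*} [CommRing R] (S : Submonoid R) (A : Type*)
    [NonUnitalNonAssocRing A] [Module R A] : Type _ :=
  LocalizedModule S A

namespace AlgLocalization

variable {R : Type*} [CommRing R] {S : Submonoid R} {A : Type*}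
  [NonUnitalNonAssocRing A] [Module R A]

instance : AddCommGroup (AlgLocalization S A) :=
  inferInstanceAs (AddCommGroup (LocalizedModule S A))

instance {k : Type*} [CommRing k] [Algebra k R] [Module k A] [IsScalarTower k R A] :
    Module k (AlgLocalization S A) :=
  inferInstanceAs (Module k (LocalizedModule S A))

/-- The fraction `a / s`. -/
def mk (a : A) (s : S) : AlgLocalization S A := LocalizedModule.mk a s

theorem mk_eq {a b : A} {s t : S} : mk a s = mk b t ↔ ∃ u : S, u • t • a = u • s • b :=
  LocalizedModule.mk_eq

theorem ind {p : AlgLocalization S A → Prop} (h : ∀ a s, p (mk a s)) (x) : p x :=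
  LocalizedModule.induction_on h x

theorem mk_add_mk (a b : A) (s t : S) : mk a s + mk b t = mk (t • a + s • b) (s * t) :=
  LocalizedModule.mk_add_mk

theorem smul_mk {k : Type*} [CommRing k] [Algebra k R] [Module k A] [IsScalarTower k R A]
    (c : k) (a : A) (s : S) : c • mk a s = mk (c • a) s :=
  LocalizedModule.smul'_mk c a s

theorem zero_mk (s : S) : mk (0 : A) s = 0 := LocalizedModule.zero_mk s

variable [IsScalarTower R A A] [SMulCommClass R A A]

instance : Mul (AlgLocalization S A) where
  mul x y := LocalizedModule.liftOn₂ x y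
    (fun p q => LocalizedModule.mk (p.1 * q.1) (p.2 * q.2)) (by
      rintro ⟨a₁, s₁⟩ ⟨a₂, s₂⟩ ⟨b₁, t₁⟩ ⟨b₂, t₂⟩ ⟨u₁, e₁⟩ ⟨u₂, e₂⟩
      refine LocalizedModule.mk_eq.2 ⟨u₁ * u₂, ?_⟩
      dsimp [Submonoid.smul_def] at *
      simp only [mul_smul_mul_comm, e₁, e₂])

theorem mk_mul_mk (a b : A) (s t : S) : mk a s * mk b t = mk (a * b) (s * t) :=
  LocalizedModule.liftOn₂_mk _ _ _ _ _ _

instance : NonUnitalNonAssocRing (AlgLocalization S A) where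
  left_distrib x y z := by
    induction x using ind with | _ a s
    induction y using ind with | _ b t
    induction z using ind with | _ c u
    simp only [mk_add_mk, mk_mul_mk]
    refine mk_eq.2 ⟨1, ?_⟩
    simp only [Submonoid.smul_def, Submonoid.coe_mul, mul_add, smul_add, mul_smul_comm, smul_smul]
    congr 2 <;> ring_nf
  right_distrib x y z := by
    induction x using ind with | _ a s
    induction y using ind with | _ b t
    induction z using ind with | _ c u
    simp only [mk_add_mk, mk_mul_mk]
    refine mk_eq.2 ⟨1, ?_⟩
    simp only [Submonoid.smul_def, Submonoid.coe_mul, add_mul, smul_add, smul_mul_assoc, smul_smul]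
    congr 2 <;> ring_nf
  zero_mul x := by
    induction x using ind with | _ a s
    rw [← zero_mk (1 : S), mk_mul_mk, zero_mul, zero_mk, zero_mk]
  mul_zero x := by
    induction x using ind with | _ a s
    rw [← zero_mk (1 : S), mk_mul_mk, mul_zero, zero_mk, zero_mk]

instance {k : Type*} [CommRing k] [Algebra k R] [Module k A] [IsScalarTower k R A]
    [IsScalarTower k A A] : IsScalarTower k (AlgLocalization S A) (AlgLocalization S A) where
  smul_assoc c x y := by
    induction x using ind with | _ a s
    induction y using ind with | _ b t
    simp only [smul_eq_mul, smul_mk, mk_mul_mk, smul_mul_assoc]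

instance {k : Type*} [CommRing k] [Algebra k R] [Module k A] [IsScalarTower k R A]
    [SMulCommClass k A A] : SMulCommClass k (AlgLocalization S A) (AlgLocalization S A) where
  smul_comm c x y := by
    induction x using ind with | _ a s
    induction y using ind with | _ b t
    simp only [smul_eq_mul, smul_mk, mk_mul_mk, mul_smul_comm]

end AlgLocalization

end AlgLocalization

/-! ### Graded algebras, multiplication algebras and centroids -/

section Graded

variable {F G A : Type*} [Field F] [NonUnitalNonAssocRing A] [Module F A]

/-- `𝒜` is a `G`-grading of the `F`-algebra `A`: `A = ⨁ 𝒜 g` and `𝒜 g * 𝒜 h ⊆ 𝒜 (g * h)`. -/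
structure IsAlgGrading [CommGroup G] (𝒜 : G → Submodule F A) : Prop where
  independent : iSupIndep 𝒜
  iSup_eq_top : ⨆ g, 𝒜 g = ⊤
  mul_mem : ∀ {g h : G} {x y : A}, x ∈ 𝒜 g → y ∈ 𝒜 h → x * y ∈ 𝒜 (g * h)

/-- A subspace is homogeneous if it is the sum of its intersections with the components. -/
def IsHomogeneousSubspace (𝒜 : G → Submodule F A) (V : Submodule F A) : Prop :=
  V = ⨆ g, V ⊓ 𝒜 g

/-- `A`, graded by `𝒜`, is graded simple: `A² ≠ 0` and the only homogeneous two-sided ideals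
are `0` and `A`. -/
structure IsGradedSimple [CommGroup G] (𝒜 : G → Submodule F A) : Prop where
  grading : IsAlgGrading 𝒜
  mul_ne_zero : ∃ x y : A, x * y ≠ 0
  eq_bot_or_eq_top : ∀ I : Submodule F A, (∀ x ∈ I, ∀ a : A, a * x ∈ I ∧ x * a ∈ I) →
    IsHomogeneousSubspace 𝒜 I → I = ⊥ ∨ I = ⊤

/-- An associative (possibly nonunital) algebra `M` of linear operators satisfies an ordinary
polynomial identity: some nonzero noncommutative polynomial vanishes under all substitutions of
elements of `M` for the variables. -/
def SatisfiesPI (M : NonUnitalSubalgebra F (Module.End F A)) : Prop :=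
  ∃ f : FreeAlgebra F ℕ, f ≠ 0 ∧
    ∀ m : ℕ → Module.End F A, (∀ i, m i ∈ M) → FreeAlgebra.lift F m f = 0

/-- A linear map of neutral degree. -/
def IsNeutralMap (𝒜 : G → Submodule F A) (φ : Module.End F A) : Prop :=
  ∀ g, ∀ x ∈ 𝒜 g, φ x ∈ 𝒜 g

variable [IsScalarTower F A A] [SMulCommClass F A A]

variable (F A) in
/-- The multiplication algebra `M(A)`: the subalgebra of `End_F A` generated by all left and
right multiplications. (Algebras are not assumed unital, and no identity is adjoined.) -/
def mulAlgebra : NonUnitalSubalgebra F (Module.End F A) :=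
  NonUnitalAlgebra.adjoin F
    (Set.range (LinearMap.mulLeft F : A → _) ∪ Set.range (LinearMap.mulRight F : A → _))

/-- `Z(M(A))_e`: the neutral component of the centre of the multiplication algebra. -/
def neutralCenter (𝒜 : G → Submodule F A) : NonUnitalSubalgebra F (Module.End F A) where
  carrier := {z | z ∈ mulAlgebra F A ∧ (∀ m ∈ mulAlgebra F A, z * m = m * z) ∧ IsNeutralMap 𝒜 z}
  zero_mem' := ⟨zero_mem _, fun m _ => by simp, fun g x _ => by simp⟩
  add_mem' := fun ⟨h1, h2, h3⟩ ⟨k1, k2, k3⟩ => ⟨add_mem h1 k1,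
    fun m hm => by rw [add_mul, mul_add, h2 m hm, k2 m hm],
    fun g x hx => add_mem (h3 g x hx) (k3 g x hx)⟩
  mul_mem' := fun {a b} ⟨h1, h2, h3⟩ ⟨k1, k2, k3⟩ => ⟨mul_mem h1 k1,
    fun m hm => by rw [mul_assoc, k2 m hm, ← mul_assoc, h2 m hm, mul_assoc],
    fun g x hx => h3 g _ (k3 g x hx)⟩
  smul_mem' := fun c a ⟨h1, h2, h3⟩ => ⟨SMulMemClass.smul_mem c h1,
    fun m hm => by rw [smul_mul_assoc, mul_smul_comm, h2 m hm],
    fun g x hx => (𝒜 g).smul_mem c (h3 g x hx)⟩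

/-- `Γ(A)_e`: the neutral component of the graded centroid, i.e. the endomorphisms of the
`M(A)`-module `A` that have neutral degree. -/
def neutralCentroid (𝒜 : G → Submodule F A) : Subalgebra F (Module.End F A) where
  carrier := {φ | (∀ m ∈ mulAlgebra F A, φ * m = m * φ) ∧ IsNeutralMap 𝒜 φ}
  add_mem' := fun ⟨h2, h3⟩ ⟨k2, k3⟩ =>
    ⟨fun m hm => by rw [add_mul, mul_add, h2 m hm, k2 m hm],
    fun g x hx => add_mem (h3 g x hx) (k3 g x hx)⟩
  mul_mem' := fun {a b} ⟨h2, h3⟩ ⟨k2, k3⟩ =>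
    ⟨fun m hm => by rw [mul_assoc, k2 m hm, ← mul_assoc, h2 m hm, mul_assoc],
    fun g x hx => h3 g _ (k3 g x hx)⟩
  algebraMap_mem' := fun c => ⟨fun m _ => Algebra.commutes c m,
    fun g x hx => (𝒜 g).smul_mem c hx⟩

theorem mulLeft_mem_mulAlgebra (a : A) : LinearMap.mulLeft F a ∈ mulAlgebra F A :=
  NonUnitalAlgebra.subset_adjoin F (Or.inl ⟨a, rfl⟩)

theorem mulRight_mem_mulAlgebra (a : A) : LinearMap.mulRight F a ∈ mulAlgebra F A :=
  NonUnitalAlgebra.subset_adjoin F (Or.inr ⟨a, rfl⟩)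

theorem neutralCentroid_mul_left {𝒜 : G → Submodule F A} {φ : Module.End F A}
    (h : φ ∈ neutralCentroid 𝒜) (x y : A) : φ (x * y) = x * φ y :=
  LinearMap.congr_fun (h.1 _ (mulLeft_mem_mulAlgebra x)) y

theorem neutralCentroid_mul_right {𝒜 : G → Submodule F A} {φ : Module.End F A}
    (h : φ ∈ neutralCentroid 𝒜) (x y : A) : φ (x * y) = φ x * y :=
  LinearMap.congr_fun (h.1 _ (mulRight_mem_mulAlgebra y)) x

theorem neutralCenter_le_neutralCentroid {𝒜 : G → Submodule F A} {φ : Module.End F A}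
    (h : φ ∈ neutralCenter 𝒜) : φ ∈ neutralCentroid 𝒜 := ⟨h.2.1, h.2.2⟩

instance (𝒜 : G → Submodule F A) : IsScalarTower (neutralCentroid 𝒜) A A where
  smul_assoc c x y := (neutralCentroid_mul_right c.2 x y).symm

instance (𝒜 : G → Submodule F A) : SMulCommClass (neutralCentroid 𝒜) A A where
  smul_comm c x y := neutralCentroid_mul_left c.2 x y

/-! ### The central localization -/

/-- The commutative ring of scalars `F + Z(M(A))_e`, acting on `A`. -/
def centralScalars (𝒜 : G → Submodule F A) : Subalgebra F (Module.End F A) :=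
  Algebra.adjoin F (neutralCenter 𝒜 : Set (Module.End F A))

instance (𝒜 : G → Submodule F A) : IsMulCommutative (centralScalars 𝒜) :=
  Algebra.isMulCommutative_adjoin F fun _ ha _ hb => ha.2.1 _ hb.1

theorem centralScalars_le_neutralCentroid (𝒜 : G → Submodule F A) :
    centralScalars 𝒜 ≤ neutralCentroid 𝒜 :=
  Algebra.adjoin_le fun _ h => neutralCenter_le_neutralCentroid h

instance (𝒜 : G → Submodule F A) : IsScalarTower (centralScalars 𝒜) A A where
  smul_assoc c x y :=
    (neutralCentroid_mul_right (centralScalars_le_neutralCentroid 𝒜 c.2) x y).symm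

instance (𝒜 : G → Submodule F A) : SMulCommClass (centralScalars 𝒜) A A where
  smul_comm c x y := neutralCentroid_mul_left (centralScalars_le_neutralCentroid 𝒜 c.2) x y

/-- The multiplicative monoid generated by `Z(M(A))_e \ {0}`. -/
def denominators (𝒜 : G → Submodule F A) : Submonoid (centralScalars 𝒜) :=
  Submonoid.closure {s | (s : Module.End F A) ∈ neutralCenter 𝒜 ∧ s ≠ 0}

/-- The central localization `S⁻¹A` for `S = Z(M(A))_e \ {0}`. -/
abbrev CentralLocalization (𝒜 : G → Submodule F A) : Type _ :=
  AlgLocalization (R := centralScalars 𝒜) (denominators 𝒜) A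

/-- The fraction `a / s` with `s ∈ Z(M(A))_e \ {0}`. -/
def centralFrac (𝒜 : G → Submodule F A) (a : A) (s : neutralCenter 𝒜) (hs : s ≠ 0) :
    CentralLocalization 𝒜 :=
  AlgLocalization.mk (R := centralScalars 𝒜) a ⟨⟨s, Algebra.subset_adjoin s.2⟩,
    Submonoid.subset_closure ⟨s.2, fun h => hs (Subtype.ext (congrArg (fun t : centralScalars 𝒜 => (t : Module.End F A)) h))⟩⟩

/-- The grading of `S⁻¹A`: the component of degree `g` consists of the `a / s` with
`a ∈ 𝒜 g`. -/
def locGrading (𝒜 : G → Submodule F A) (g : G) : Submodule F (CentralLocalization 𝒜) :=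
  Submodule.span F {x | ∃ a ∈ 𝒜 g, ∃ s : denominators 𝒜, x = AlgLocalization.mk (R := centralScalars 𝒜) a s}

end Graded

/-! ### The algebra of generic elements -/

section Generic

/-- The field of fractions of the polynomial ring over `F` in the variables `t_{ij}^g`,
`1 ≤ i, j ≤ n g`. -/
abbrev GenericField (F : Type*) {G : Type*} [Field F] (n : G → ℕ) : Type _ :=
  FractionRing (MvPolynomial (Σ g : G, Fin (n g) × Fin (n g)) F)

variable {F G U : Type*} [Field F] [NonUnitalNonAssocRing U] [Module F U]
  [IsScalarTower F U U] [SMulCommClass F U U]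
  (E : Type*) [Field E] [Algebra F E]

variable (F) in
/-- The variable `t_{ij}^g` as an element of an extension `E` of the generic field. -/
def genericVar (n : G → ℕ) [Algebra (GenericField F n) E] (g : G) (i j : Fin (n g)) : E :=
  algebraMap (GenericField F n) E
    (algebraMap (MvPolynomial (Σ g : G, Fin (n g) × Fin (n g)) F) (GenericField F n)
      (MvPolynomial.X ⟨g, i, j⟩))

variable {𝒰 : G → Submodule F U} {n : G → ℕ} [Algebra (GenericField F n) E]
  (u : ∀ g, Module.Basis (Fin (n g)) F (𝒰 g))

/-- The generic element `y_i^g = ∑ j, t_{ij}^g ⊗ u_j^g` of `E ⊗ U`. -/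
def genericElement (g : G) (i : Fin (n g)) : E ⊗[F] U :=
  ∑ j, genericVar F E n g i j ⊗ₜ[F] (u g j : U)

/-- The algebra of generic elements: the `F`-subalgebra of `E ⊗ U` generated by the `y_i^g`. -/
def genericAlgebra : NonUnitalSubalgebra F (E ⊗[F] U) :=
  NonUnitalAlgebra.adjoin F {y | ∃ (g : G) (i : Fin (n g)), y = genericElement E u g i}

/-- The algebra of generic elements `F_U` as a type. -/
def GenericAlg : Type _ := genericAlgebra E u

instance : NonUnitalNonAssocRing (GenericAlg E u) :=
  inferInstanceAs (NonUnitalNonAssocRing (genericAlgebra E u))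

instance : Module F (GenericAlg E u) := inferInstanceAs (Module F (genericAlgebra E u))

instance : IsScalarTower F (GenericAlg E u) (GenericAlg E u) :=
  inferInstanceAs (IsScalarTower F (genericAlgebra E u) (genericAlgebra E u))

instance : SMulCommClass F (GenericAlg E u) (GenericAlg E u) :=
  inferInstanceAs (SMulCommClass F (genericAlgebra E u) (genericAlgebra E u))

/-- The inclusion of `F_U` into `E ⊗ U`. -/
def GenericAlg.incl : GenericAlg E u →ₙₐ[F] E ⊗[F] U :=
  NonUnitalSubalgebraClass.subtype (genericAlgebra E u)

/-- The grading of the algebra of generic elements induced by `(E ⊗ U)_g = E ⊗ U_g`. -/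
def genericGrading (g : G) : Submodule F (GenericAlg E u) :=
  (((𝒰 g).baseChange E).restrictScalars F).comap (GenericAlg.incl E u : _ →ₗ[F] E ⊗[F] U)

/-- `Z_U`, the neutral component of the centre of `M(F_U)`. -/
abbrev genericCenter : NonUnitalSubalgebra F (Module.End F (GenericAlg E u)) :=
  neutralCenter (genericGrading E u)

/-- `S⁻¹F_U` for `S = Z_U \ {0}`. -/
abbrev GenericLoc : Type _ := CentralLocalization (genericGrading E u)

/-- The grading of `S⁻¹F_U`. -/
abbrev genericLocGrading : G → Submodule F (GenericLoc E u) := locGrading (genericGrading E u)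

/-- `K_U = Γ(S⁻¹F_U)_e`. -/
abbrev genericCentroid : Subalgebra F (Module.End F (GenericLoc E u)) :=
  neutralCentroid (genericLocGrading E u)

end Generic

end

/-!
Write `V = E ⊗ U` and let `R ⊆ V` be the generic algebra. Since the generic matrices are invertible,
the generic elements form a homogeneous `E`-basis of `V`. By graded simplicity `U` is a simple
module over the algebra generated by the multiplications and the homogeneous projections, with
commutant `Γ(U)_e = F`; by Jacobson density this algebra is `End_F U`, hence its analogue on `V` is
`End_E V`.

The main point is that the scalars in `M(R)` are plentiful. Density provides, for every `g` in the
support, an alternating map `f` in `dim V_g` variables from `V_g` that sends elements of `R` to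
elements of neutral degree of `M(R)` and does not vanish on the generic basis. For an operator `A`
of neutral degree the sum of the values of `f` with `A` applied to one argument is
`tr(A|V_g) • f`. Therefore the values of `f` on `R` span a module over the ring `T` generated by the
traces of such operators in `M(R)`, and Cramer's rule together with a trace computation puts the
coordinates of the elements of `R` in the fraction field of `T`. The identity of `V` is a linear
combination of operators `a * f(y) * b`, and clearing denominators in it shows that `T * t` consists
of scalars in `M(R)` for some `t ≠ 0`.

Consequently the coordinates of `R` lie in the field `K` generated by these scalars, and the central
localization of `R` becomes the set of all vectors with coordinates in `K`, a `K`-form of `V`.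
Graded simplicity, the centroid and the isomorphism with `V` after extension of scalars are then
read off from `V`, and the polynomial identity is the standard identity of the finite-dimensional
algebra `End_E V`.
-/

open scoped TensorProduct IsMulCommutative

noncomputable section

section HomogeneousBasis

open Module

variable {E G V I : Type*} [CommRing E] [AddCommGroup V] [Module E V]

/-- `y` is a basis of homogeneous elements, with `y i` of degree `deg i`, for the family of
components `𝒱`. -/
def IsHomogeneousBasis (𝒱 : G → Submodule E V) (y : Basis I E V) (deg : I → G) : Prop :=
  ∀ g, 𝒱 g = Submodule.span E (y '' (deg ⁻¹' {g}))

open Classical in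
/-- The projection onto the component of degree `g` along the other components. -/
def homogeneousProj (y : Basis I E V) (deg : I → G) (g : G) : End E V :=
  y.constr E fun i => if deg i = g then y i else 0

theorem homogeneousProj_basis_self (y : Basis I E V) (deg : I → G) (i : I) :
    homogeneousProj y deg (deg i) (y i) = y i := by
  simp [homogeneousProj, Basis.constr_basis]

theorem homogeneousProj_basis_of_ne (y : Basis I E V) {deg : I → G} {i : I} {g : G}
    (h : deg i ≠ g) : homogeneousProj y deg g (y i) = 0 := by
  simp [homogeneousProj, Basis.constr_basis, h]

open Classical in
theorem sum_homogeneousProj [Fintype I] (y : Basis I E V) (deg : I → G) (v : V) :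
    ∑ g ∈ Finset.univ.image deg, homogeneousProj y deg g v = v := by
  suffices h : ∑ g ∈ Finset.univ.image deg, homogeneousProj y deg g = LinearMap.id by
    simpa using congr($h v)
  refine y.ext fun i => ?_
  rw [LinearMap.sum_apply, Finset.sum_eq_single (deg i)]
  · exact homogeneousProj_basis_self y deg i
  · exact fun g _ hg => homogeneousProj_basis_of_ne y hg.symm
  · exact fun h => absurd (Finset.mem_image_of_mem deg (Finset.mem_univ i)) h

namespace IsHomogeneousBasis

variable {𝒱 : G → Submodule E V} {y : Basis I E V} {deg : I → G}

theorem basis_mem (hy : IsHomogeneousBasis 𝒱 y deg) (i : I) : y i ∈ 𝒱 (deg i) := by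
  rw [hy]
  exact Submodule.subset_span ⟨i, rfl, rfl⟩

theorem mem_iff (hy : IsHomogeneousBasis 𝒱 y deg) {g : G} {v : V} :
    v ∈ 𝒱 g ↔ ∀ i, deg i ≠ g → y.repr v i = 0 := by
  rw [hy, Basis.mem_span_image]
  simp only [Set.subset_def, Finset.mem_coe, Finsupp.mem_support_iff, Set.mem_preimage,
    Set.mem_singleton_iff]
  exact forall_congr' fun i => not_imp_comm

theorem eqOn (hy : IsHomogeneousBasis 𝒱 y deg) {N : Type*} [AddCommGroup N] [Module E N]
    {S T : V →ₗ[E] N} {g : G} (h : ∀ i, deg i = g → S (y i) = T (y i)) {v : V} (hv : v ∈ 𝒱 g) :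
    S v = T v := by
  rw [hy] at hv
  exact LinearMap.eqOn_span (Set.forall_mem_image.2 h) hv

theorem proj_apply_of_mem (hy : IsHomogeneousBasis 𝒱 y deg) {g : G} {v : V} (hv : v ∈ 𝒱 g) :
    homogeneousProj y deg g v = v :=
  hy.eqOn (T := LinearMap.id) (by rintro i rfl; exact homogeneousProj_basis_self y deg i) hv

theorem proj_apply_of_mem_of_ne (hy : IsHomogeneousBasis 𝒱 y deg) {g h : G} {v : V}
    (hv : v ∈ 𝒱 g) (hgh : g ≠ h) : homogeneousProj y deg h v = 0 :=
  hy.eqOn (T := 0) (by rintro i rfl; exact homogeneousProj_basis_of_ne y hgh) hv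

theorem proj_mem (hy : IsHomogeneousBasis 𝒱 y deg) (g : G) (v : V) :
    homogeneousProj y deg g v ∈ 𝒱 g := by
  suffices h : ⊤ ≤ (𝒱 g).comap (homogeneousProj y deg g) from h Submodule.mem_top
  rw [← y.span_eq, Submodule.span_le]
  rintro _ ⟨i, rfl⟩
  rw [SetLike.mem_coe, Submodule.mem_comap]
  by_cases h : deg i = g
  · subst h
    rw [homogeneousProj_basis_self]
    exact hy.basis_mem i
  · rw [homogeneousProj_basis_of_ne y h]
    exact zero_mem _

theorem isHomogeneousSubspace {F U : Type*} [Field F] [NonUnitalNonAssocRing U] [Module F U]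
    [Finite I] {𝒰 : G → Submodule F U} {b : Basis I F U} (hb : IsHomogeneousBasis 𝒰 b deg)
    {N : Submodule F U} (hN : ∀ g, ∀ x ∈ N, homogeneousProj b deg g x ∈ N) :
    IsHomogeneousSubspace 𝒰 N := by
  classical
  have := Fintype.ofFinite I
  refine le_antisymm (fun x hx => ?_) (iSup_le fun g => inf_le_left)
  rw [← sum_homogeneousProj b deg x]
  exact sum_mem fun g _ => Submodule.mem_iSup_of_mem g ⟨hN g x hx, hb.proj_mem g x⟩

end IsHomogeneousBasis

end HomogeneousBasis

section Density

open Module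

variable {F G U I : Type*} [Field F] [NonUnitalNonAssocRing U] [Module F U]
  [IsScalarTower F U U] [SMulCommClass F U U]

/-- The unital algebra of operators generated by all multiplications and by the projections onto
the homogeneous components; its invariant subspaces are the homogeneous two-sided ideals. -/
def gradedMulAlgebra (b : Basis I F U) (deg : I → G) : Subalgebra F (End F U) :=
  Algebra.adjoin F (Set.range (LinearMap.mulLeft F : U → End F U) ∪
    Set.range (LinearMap.mulRight F : U → End F U) ∪ Set.range (homogeneousProj b deg))

section

variable (b : Basis I F U) (deg : I → G)

theorem mulLeft_mem_gradedMulAlgebra (a : U) : LinearMap.mulLeft F a ∈ gradedMulAlgebra b deg :=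
  Algebra.subset_adjoin (Or.inl (Or.inl ⟨a, rfl⟩))

theorem mulRight_mem_gradedMulAlgebra (a : U) : LinearMap.mulRight F a ∈ gradedMulAlgebra b deg :=
  Algebra.subset_adjoin (Or.inl (Or.inr ⟨a, rfl⟩))

theorem homogeneousProj_mem_gradedMulAlgebra (g : G) :
    homogeneousProj b deg g ∈ gradedMulAlgebra b deg :=
  Algebra.subset_adjoin (Or.inr ⟨g, rfl⟩)

theorem mulAlgebra_le_gradedMulAlgebra :
    mulAlgebra F U ≤ (gradedMulAlgebra b deg).toNonUnitalSubalgebra := by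
  refine NonUnitalAlgebra.adjoin_le ?_
  rintro _ (⟨a, rfl⟩ | ⟨a, rfl⟩)
  exacts [mulLeft_mem_gradedMulAlgebra b deg a, mulRight_mem_gradedMulAlgebra b deg a]

end

variable {𝒰 : G → Submodule F U} {b : Basis I F U} {deg : I → G}

theorem exists_eq_smul_of_gradedMulAlgebra (hΓ : neutralCentroid 𝒰 = ⊥)
    (hb : IsHomogeneousBasis 𝒰 b deg) (φ : End (gradedMulAlgebra b deg) U) :
    ∃ c : F, ∀ x, φ x = c • x := by
  have hcomm {m : End F U} (hm : m ∈ gradedMulAlgebra b deg) (x : U) : φ (m x) = m (φ x) :=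
    φ.map_smul ⟨m, hm⟩ x
  have hφ : (φ.restrictScalars F : End F U) ∈ neutralCentroid 𝒰 := by
    refine ⟨fun m hm => LinearMap.ext (hcomm (mulAlgebra_le_gradedMulAlgebra b deg hm)),
      fun g x hx => ?_⟩
    have := hcomm (homogeneousProj_mem_gradedMulAlgebra b deg g) x
    rw [hb.proj_apply_of_mem hx] at this
    rw [LinearMap.restrictScalars_apply, this]
    exact hb.proj_mem g _
  rw [hΓ] at hφ
  obtain ⟨c, hc⟩ := Algebra.mem_bot.1 hφ
  exact ⟨c, fun x => congr($hc.symm x)⟩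

variable [CommGroup G]

theorem IsGradedSimple.isSimpleModule_gradedMulAlgebra [Finite I] (hU : IsGradedSimple 𝒰)
    (hb : IsHomogeneousBasis 𝒰 b deg) : IsSimpleModule (gradedMulAlgebra b deg) U := by
  obtain ⟨x, y, hxy⟩ := hU.mul_ne_zero
  have : Nontrivial U := ⟨_, _, hxy⟩
  refine { exists_pair_ne := ⟨⊥, ⊤, bot_ne_top⟩, eq_bot_or_eq_top := fun N => ?_ }
  have h := hU.eq_bot_or_eq_top (N.restrictScalars F)
    (fun x hx a => ⟨N.smul_mem ⟨_, mulLeft_mem_gradedMulAlgebra b deg a⟩ hx,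
      N.smul_mem ⟨_, mulRight_mem_gradedMulAlgebra b deg a⟩ hx⟩)
    (hb.isHomogeneousSubspace fun g x hx =>
      N.smul_mem ⟨_, homogeneousProj_mem_gradedMulAlgebra b deg g⟩ hx)
  exact h.imp (Submodule.restrictScalars_eq_bot_iff F _ U).1
    (Submodule.restrictScalars_eq_top_iff F _ U).1

theorem IsGradedSimple.gradedMulAlgebra_eq_top [Finite I] (hU : IsGradedSimple 𝒰)
    (hΓ : neutralCentroid 𝒰 = ⊥) (hb : IsHomogeneousBasis 𝒰 b deg) :
    gradedMulAlgebra b deg = ⊤ := by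
  classical
  have := Fintype.ofFinite I
  have := hU.isSimpleModule_gradedMulAlgebra hb
  refine eq_top_iff.2 fun T _ => ?_
  let f : End (End (gradedMulAlgebra b deg) U) U :=
    { toFun := T
      map_add' := T.map_add
      map_smul' := fun φ x => by
        obtain ⟨c, hc⟩ := exists_eq_smul_of_gradedMulAlgebra hΓ hb φ
        simp only [Module.End.smul_def, hc, map_smul, RingHom.id_apply] }
  obtain ⟨r, hr⟩ := jacobson_density f (Finset.univ.image b)
  have hT : T = r.1 := b.ext fun i => hr (b i) (Finset.mem_image_of_mem _ (Finset.mem_univ i))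
  exact hT ▸ r.2

end Density

section BaseChange

open Module

variable {F E G U I J : Type*} [Field F] [NonUnitalNonAssocRing U] [Module F U]
  [Field E] [Algebra F E]
  {𝒰 : G → Submodule F U} {b : Basis I F U} {deg : I → G}
  {y : Basis J E (E ⊗[F] U)} {deg' : J → G}

theorem baseChange_homogeneousProj (hb : IsHomogeneousBasis 𝒰 b deg)
    (hy : IsHomogeneousBasis (fun g => (𝒰 g).baseChange E) y deg') (g : G) :
    (homogeneousProj b deg g).baseChange E = homogeneousProj y deg' g := by
  refine (b.baseChange E).ext fun i => ?_
  have hi := Submodule.tmul_mem_baseChange_of_mem (1 : E) (hb.basis_mem i)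
  rw [Basis.baseChange_apply, LinearMap.baseChange_tmul]
  by_cases hg : deg i = g
  · subst hg
    rw [homogeneousProj_basis_self, hy.proj_apply_of_mem hi]
  · rw [homogeneousProj_basis_of_ne b hg, hy.proj_apply_of_mem_of_ne hi hg,
      TensorProduct.tmul_zero]

variable [IsScalarTower F U U] [SMulCommClass F U U]

theorem baseChange_mulLeft (a : U) :
    (LinearMap.mulLeft F a).baseChange E = LinearMap.mulLeft E ((1 : E) ⊗ₜ[F] a) := by
  ext
  simp

theorem baseChange_mulRight (a : U) :
    (LinearMap.mulRight F a).baseChange E = LinearMap.mulRight E ((1 : E) ⊗ₜ[F] a) := by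
  ext
  simp

theorem gradedMulAlgebra_baseChange_eq_top [FiniteDimensional F U]
    (hb : IsHomogeneousBasis 𝒰 b deg) (h : gradedMulAlgebra b deg = ⊤)
    (hy : IsHomogeneousBasis (fun g => (𝒰 g).baseChange E) y deg') :
    gradedMulAlgebra y deg' = ⊤ := by
  have hbase (T : End F U) : T.baseChange E ∈ gradedMulAlgebra y deg' := by
    suffices hle : gradedMulAlgebra b deg ≤ ((gradedMulAlgebra y deg').restrictScalars F).comap
        (End.baseChangeHom F E U) from hle (h ▸ Algebra.mem_top)
    refine Algebra.adjoin_le ?_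
    rintro _ ((⟨a, rfl⟩ | ⟨a, rfl⟩) | ⟨g, rfl⟩)
    · change (LinearMap.mulLeft F a).baseChange E ∈ gradedMulAlgebra y deg'
      rw [baseChange_mulLeft]
      exact mulLeft_mem_gradedMulAlgebra y deg' _
    · change (LinearMap.mulRight F a).baseChange E ∈ gradedMulAlgebra y deg'
      rw [baseChange_mulRight]
      exact mulRight_mem_gradedMulAlgebra y deg' _
    · change (homogeneousProj b deg g).baseChange E ∈ gradedMulAlgebra y deg'
      rw [baseChange_homogeneousProj hb hy]
      exact homogeneousProj_mem_gradedMulAlgebra y deg' g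
  have := Module.finitePresentation_of_finite F U
  exact eq_top_iff.2 fun T _ => (FinitePresentation.isBaseChange_map F U U E).inductionOn T
    (· ∈ gradedMulAlgebra y deg') (zero_mem _) hbase (fun c S hS => Subalgebra.smul_mem _ hS c)
    fun S T hS hT => add_mem hS hT

end BaseChange

section HomogeneousOperators

open Module

theorem exists_mem_apply_ne_zero_of_mem_span {k M N : Type*} [Semiring k] [AddCommMonoid M]
    [Module k M] [AddCommMonoid N] [Module k N] {s : Set M} {x : M}
    (hx : x ∈ Submodule.span k s) (f : M →ₗ[k] N) (h : f x ≠ 0) : ∃ m ∈ s, f m ≠ 0 := by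
  by_contra! hs
  exact h (Submodule.span_le.2 (show s ⊆ LinearMap.ker f from hs) hx)

theorem exists_basis_mul_ne_zero {E V I : Type*} [CommRing E] [NonUnitalNonAssocRing V]
    [Module E V] [IsScalarTower E V V] [SMulCommClass E V V] (y : Basis I E V)
    (h : ∃ v w : V, v * w ≠ 0) : ∃ i j, y i * y j ≠ 0 := by
  by_contra! hy
  have hmul : LinearMap.mul E V = 0 := y.ext fun i => y.ext fun j => hy i j
  obtain ⟨v, w, hvw⟩ := h
  exact hvw congr($hmul v w)

variable {F E G V I : Type*} [Field F] [Field E] [Algebra F E] [NonUnitalNonAssocRing V]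
  [Module F V] [Module E V] [IsScalarTower F E V] [IsScalarTower E V V] [SMulCommClass E V V]

section MultiplicationAlgebra

variable (E) in
/-- The left and right multiplications of the `E`-algebra `V` by elements of `R`. -/
def multiplicationsBy (R : NonUnitalSubalgebra F V) : Set (End E V) :=
  LinearMap.mulLeft E '' R ∪ LinearMap.mulRight E '' R

variable (E) in
/-- The multiplication algebra of an `F`-form `R` of the `E`-algebra `V`, acting on `V`. -/
def formMulAlgebra (R : NonUnitalSubalgebra F V) : NonUnitalSubalgebra F (End E V) :=
  NonUnitalAlgebra.adjoin F (multiplicationsBy E R)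

variable (E) in
/-- The multiplication algebra of an `F`-form `R` of `V` with an identity adjoined. -/
def unitalFormMulAlgebra (R : NonUnitalSubalgebra F V) : Subalgebra F (End E V) :=
  Algebra.adjoin F (multiplicationsBy E R)

variable {R : NonUnitalSubalgebra F V} {r : V} {m q : End E V}

theorem mul_mem_formMulAlgebra_of_left_mem (hm : m ∈ unitalFormMulAlgebra E R)
    (hq : q ∈ formMulAlgebra E R) : m * q ∈ formMulAlgebra E R := by
  induction hm using Algebra.adjoin_induction generalizing q with
  | mem m hm => exact mul_mem (NonUnitalAlgebra.subset_adjoin F hm) hq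
  | algebraMap c => exact Algebra.smul_def c q ▸ SMulMemClass.smul_mem c hq
  | add m m' _ _ ih ih' => exact add_mul m m' q ▸ add_mem (ih hq) (ih' hq)
  | mul m m' _ _ ih ih' => exact mul_assoc m m' q ▸ ih (ih' hq)

theorem mul_mem_formMulAlgebra_of_right_mem (hq : q ∈ formMulAlgebra E R)
    (hm : m ∈ unitalFormMulAlgebra E R) : q * m ∈ formMulAlgebra E R := by
  induction hm using Algebra.adjoin_induction generalizing q with
  | mem m hm => exact mul_mem hq (NonUnitalAlgebra.subset_adjoin F hm)
  | algebraMap c =>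
    rw [← Algebra.commutes, ← Algebra.smul_def]
    exact SMulMemClass.smul_mem c hq
  | add m m' _ _ ih ih' => exact mul_add q m m' ▸ add_mem (ih hq) (ih' hq)
  | mul m m' _ _ ih ih' => exact mul_assoc q m m' ▸ ih' (ih hq)

theorem formMulAlgebra_le_unitalFormMulAlgebra :
    formMulAlgebra E R ≤ (unitalFormMulAlgebra E R).toNonUnitalSubalgebra :=
  NonUnitalAlgebra.adjoin_le Algebra.subset_adjoin

theorem apply_mem_of_forall_mul_mem {N : Submodule F V}
    (hN : ∀ r ∈ R, ∀ v ∈ N, r * v ∈ N ∧ v * r ∈ N) (hm : m ∈ unitalFormMulAlgebra E R) {v : V}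
    (hv : v ∈ N) : m v ∈ N := by
  induction hm using Algebra.adjoin_induction generalizing v with
  | mem m hm =>
    obtain ⟨r, hr, rfl⟩ | ⟨r, hr, rfl⟩ := hm
    exacts [(hN r hr v hv).1, (hN r hr v hv).2]
  | algebraMap c => exact N.smul_mem c hv
  | add m m' _ _ ih ih' => exact add_mem (ih hv) (ih' hv)
  | mul _ _ _ _ ih ih' => exact ih (ih' hv)

theorem apply_mem_of_mem_unitalFormMulAlgebra (hm : m ∈ unitalFormMulAlgebra E R) (hr : r ∈ R) :
    m r ∈ R :=
  apply_mem_of_forall_mul_mem (N := R.toSubmodule)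
    (fun _ hs _ hv => ⟨R.mul_mem hs hv, R.mul_mem hv hs⟩) hm hr

end MultiplicationAlgebra

variable [CommGroup G]

/-- `m` is homogeneous of degree `d`, that is, `m (𝒱 g) ⊆ 𝒱 (d * g)`. -/
def IsHomogeneousMap (𝒱 : G → Submodule E V) (d : G) (m : End E V) : Prop :=
  ∀ g, ∀ v ∈ 𝒱 g, m v ∈ 𝒱 (d * g)

/-- The operators of degree `d` in the unital multiplication algebra of `R`. -/
def homogeneousOps (𝒱 : G → Submodule E V) (R : NonUnitalSubalgebra F V) (d : G) :
    Submodule F (End E V) where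
  carrier := {m | m ∈ unitalFormMulAlgebra E R ∧ IsHomogeneousMap 𝒱 d m}
  zero_mem' := ⟨zero_mem _, fun _ _ _ => zero_mem _⟩
  add_mem' hm hm' := ⟨add_mem hm.1 hm'.1, fun g v hv => add_mem (hm.2 g v hv) (hm'.2 g v hv)⟩
  smul_mem' c _ hm := ⟨Subalgebra.smul_mem _ hm.1 c,
    fun g v hv => Submodule.smul_of_tower_mem _ c (hm.2 g v hv)⟩

/-- The operators of neutral degree in the multiplication algebra of `R`. -/
def neutralOps (𝒱 : G → Submodule E V) (R : NonUnitalSubalgebra F V) :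
    NonUnitalSubalgebra F (End E V) where
  carrier := {m | m ∈ formMulAlgebra E R ∧ IsNeutralMap 𝒱 m}
  zero_mem' := ⟨zero_mem _, fun _ _ _ => zero_mem _⟩
  add_mem' hm hm' := ⟨add_mem hm.1 hm'.1, fun g v hv => add_mem (hm.2 g v hv) (hm'.2 g v hv)⟩
  mul_mem' hm hm' := ⟨mul_mem hm.1 hm'.1, fun g v hv => hm.2 g _ (hm'.2 g v hv)⟩
  smul_mem' c _ hm := ⟨SMulMemClass.smul_mem c hm.1,
    fun g v hv => Submodule.smul_of_tower_mem _ c (hm.2 g v hv)⟩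

section

variable {𝒱 : G → Submodule E V} {R : NonUnitalSubalgebra F V} {d d' : G} {m m' : End E V}

theorem one_mem_homogeneousOps : (1 : End E V) ∈ homogeneousOps 𝒱 R 1 :=
  ⟨one_mem _, fun g v hv => by rwa [one_mul]⟩

theorem mul_mem_homogeneousOps (hm : m ∈ homogeneousOps 𝒱 R d)
    (hm' : m' ∈ homogeneousOps 𝒱 R d') : m * m' ∈ homogeneousOps 𝒱 R (d * d') :=
  ⟨mul_mem hm.1 hm'.1, fun g v hv => mul_assoc d d' g ▸ hm.2 _ _ (hm'.2 _ v hv)⟩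

theorem mul_mem_span_homogeneousOps
    (hm : m ∈ Submodule.span E (homogeneousOps 𝒱 R d : Set (End E V)))
    (hm' : m' ∈ Submodule.span E (homogeneousOps 𝒱 R d' : Set (End E V))) :
    m * m' ∈ Submodule.span E (homogeneousOps 𝒱 R (d * d') : Set (End E V)) := by
  have h := Submodule.mul_mem_mul hm hm'
  rw [Submodule.span_mul_span] at h
  refine Submodule.span_mono ?_ h
  rintro _ ⟨x, hx, z, hz, rfl⟩
  exact mul_mem_homogeneousOps hx hz

theorem isHomogeneousMap_of_mem_span
    (hm : m ∈ Submodule.span E (homogeneousOps 𝒱 R d : Set (End E V))) :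
    IsHomogeneousMap 𝒱 d m := by
  intro g v hv
  induction hm using Submodule.span_induction with
  | mem m hm => exact hm.2 g v hv
  | zero => exact zero_mem _
  | add m m' _ _ ih ih' => exact add_mem ih ih'
  | smul c m _ ih => exact Submodule.smul_mem _ c ih

end

/-- An `F`-subalgebra `R` of a graded `E`-algebra `V` that contains a homogeneous `E`-basis `y`
of `V`, where `V` is such that multiplications and homogeneous projections generate all
operators. -/
structure IsDenseForm (𝒱 : G → Submodule E V) (R : NonUnitalSubalgebra F V) (y : Basis I E V)
    (deg : I → G) : Prop where
  basis : IsHomogeneousBasis 𝒱 y deg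
  mul_mem : ∀ {g h : G} {v w : V}, v ∈ 𝒱 g → w ∈ 𝒱 h → v * w ∈ 𝒱 (g * h)
  basis_mem : ∀ i, y i ∈ R
  mul_ne_zero : ∃ v w : V, v * w ≠ 0
  gradedMulAlgebra_eq_top : gradedMulAlgebra y deg = ⊤

namespace IsDenseForm

variable {𝒱 : G → Submodule E V} {R : NonUnitalSubalgebra F V} {y : Basis I E V} {deg : I → G}

theorem mulLeft_mem_homogeneousOps (hR : IsDenseForm 𝒱 R y deg) {r : V} {g : G} (hr : r ∈ R)
    (hrg : r ∈ 𝒱 g) : LinearMap.mulLeft E r ∈ homogeneousOps 𝒱 R g :=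
  ⟨Algebra.subset_adjoin (Or.inl ⟨r, hr, rfl⟩), fun _ _ hv => hR.mul_mem hrg hv⟩

theorem mulRight_mem_homogeneousOps (hR : IsDenseForm 𝒱 R y deg) {r : V} {g : G} (hr : r ∈ R)
    (hrg : r ∈ 𝒱 g) : LinearMap.mulRight E r ∈ homogeneousOps 𝒱 R g :=
  ⟨Algebra.subset_adjoin (Or.inr ⟨r, hr, rfl⟩),
    fun _ _ hv => mul_comm g _ ▸ hR.mul_mem hv hrg⟩

/-- The operators all of whose matrix blocks with respect to the grading are induced by
`E`-combinations of homogeneous operators in the unital multiplication algebra of `R`. -/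
def blockInducedOps (𝒱 : G → Submodule E V) (R : NonUnitalSubalgebra F V) (y : Basis I E V)
    (deg : I → G) : Submodule E (End E V) where
  carrier := {T | ∀ g h, ∃ a ∈ Submodule.span E (homogeneousOps 𝒱 R (h * g⁻¹) : Set (End E V)),
    ∀ v ∈ 𝒱 g, a v = homogeneousProj y deg h (T v)}
  zero_mem' _ _ := ⟨0, zero_mem _, fun v _ => by simp⟩
  add_mem' {S T} hS hT g h := by
    obtain ⟨a, ha, haS⟩ := hS g h
    obtain ⟨b, hb, hbT⟩ := hT g h
    exact ⟨a + b, add_mem ha hb, fun v hv => by simp [haS v hv, hbT v hv]⟩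
  smul_mem' c T hT g h := by
    obtain ⟨a, ha, haT⟩ := hT g h
    exact ⟨c • a, Submodule.smul_mem _ c ha, fun v hv => by simp [haT v hv]⟩

theorem mem_blockInducedOps_of_mem_homogeneousOps (hR : IsDenseForm 𝒱 R y deg) {d : G}
    {m : End E V} (hm : m ∈ homogeneousOps 𝒱 R d) : m ∈ blockInducedOps 𝒱 R y deg := by
  intro g h
  by_cases hd : d * g = h
  · subst hd
    refine ⟨m, Submodule.subset_span (by rwa [mul_inv_cancel_right]), fun v hv => ?_⟩
    rw [hR.basis.proj_apply_of_mem (hm.2 g v hv)]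
  · refine ⟨0, zero_mem _, fun v hv => ?_⟩
    rw [hR.basis.proj_apply_of_mem_of_ne (hm.2 g v hv) hd, LinearMap.zero_apply]

theorem homogeneousProj_mem_blockInducedOps (hR : IsDenseForm 𝒱 R y deg) (l : G) :
    homogeneousProj y deg l ∈ blockInducedOps 𝒱 R y deg := by
  intro g h
  by_cases hl : g = l
  · subst hl
    obtain ⟨a, ha, ha'⟩ := hR.mem_blockInducedOps_of_mem_homogeneousOps one_mem_homogeneousOps g h
    exact ⟨a, ha, fun v hv => by rw [ha' v hv, hR.basis.proj_apply_of_mem hv, Module.End.one_apply]⟩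
  · refine ⟨0, zero_mem _, fun v hv => ?_⟩
    rw [hR.basis.proj_apply_of_mem_of_ne hv hl, map_zero, LinearMap.zero_apply]

theorem mul_mem_blockInducedOps [Finite I] (hR : IsDenseForm 𝒱 R y deg) {S T : End E V}
    (hS : S ∈ blockInducedOps 𝒱 R y deg) (hT : T ∈ blockInducedOps 𝒱 R y deg) :
    S * T ∈ blockInducedOps 𝒱 R y deg := by
  classical
  have := Fintype.ofFinite I
  intro g h
  choose a ha haS using fun l => hS l h
  choose b hb hbT using fun l => hT g l
  refine ⟨∑ l ∈ Finset.univ.image deg, a l * b l, sum_mem fun l _ => ?_, fun v hv => ?_⟩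
  · convert mul_mem_span_homogeneousOps (ha l) (hb l) using 4
    group
  · rw [Module.End.mul_apply, ← sum_homogeneousProj y deg (T v), map_sum, map_sum,
      LinearMap.sum_apply]
    refine Finset.sum_congr rfl fun l _ => ?_
    rw [Module.End.mul_apply, hbT l v hv, haS l _ (hR.basis.proj_mem l _)]

theorem blockInducedOps_eq_top [Finite I] (hR : IsDenseForm 𝒱 R y deg) :
    blockInducedOps 𝒱 R y deg = ⊤ := by
  have hmul {f : V →ₗ[E] End E V} (hf : ∀ i, f (y i) ∈ homogeneousOps 𝒱 R (deg i)) (v : V) :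
      f v ∈ blockInducedOps 𝒱 R y deg := by
    suffices h : ⊤ ≤ (blockInducedOps 𝒱 R y deg).comap f from h Submodule.mem_top
    rw [← y.span_eq, Submodule.span_le]
    rintro _ ⟨i, rfl⟩
    exact hR.mem_blockInducedOps_of_mem_homogeneousOps (hf i)
  have hone := hR.mem_blockInducedOps_of_mem_homogeneousOps one_mem_homogeneousOps
  refine eq_top_iff.2 fun T _ => ?_
  have hT : T ∈ gradedMulAlgebra y deg := hR.gradedMulAlgebra_eq_top ▸ Algebra.mem_top
  induction hT using Algebra.adjoin_induction with
  | mem T hT =>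
    obtain ((⟨v, rfl⟩ | ⟨v, rfl⟩) | ⟨l, rfl⟩) := hT
    · exact hmul (f := LinearMap.mul E V) (fun i =>
        hR.mulLeft_mem_homogeneousOps (hR.basis_mem i) (hR.basis.basis_mem i)) v
    · exact hmul (f := (LinearMap.mul E V).flip) (fun i =>
        hR.mulRight_mem_homogeneousOps (hR.basis_mem i) (hR.basis.basis_mem i)) v
    · exact hR.homogeneousProj_mem_blockInducedOps l
  | algebraMap c =>
    exact Algebra.algebraMap_eq_smul_one (A := End E V) c ▸ Submodule.smul_mem _ c hone
  | add S T _ _ hS hT => exact add_mem (hS trivial) (hT trivial)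
  | mul S T _ _ hS hT => exact hR.mul_mem_blockInducedOps (hS trivial) (hT trivial)

theorem exists_mem_span_homogeneousOps_eqOn [Finite I] (hR : IsDenseForm 𝒱 R y deg)
    (T : End E V) (g h : G) :
    ∃ a ∈ Submodule.span E (homogeneousOps 𝒱 R (h * g⁻¹) : Set (End E V)),
      ∀ v ∈ 𝒱 g, a v = homogeneousProj y deg h (T v) := by
  have hT : T ∈ blockInducedOps 𝒱 R y deg := by
    rw [hR.blockInducedOps_eq_top]
    exact Submodule.mem_top
  exact hT g h

theorem exists_mem_span_homogeneousOps_eq_smul [Finite I] (hR : IsDenseForm 𝒱 R y deg)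
    (f : Dual E V) {h : G} {w : V} (hw : w ∈ 𝒱 h) (g : G) :
    ∃ a ∈ Submodule.span E (homogeneousOps 𝒱 R (h * g⁻¹) : Set (End E V)),
      ∀ v ∈ 𝒱 g, a v = f v • w := by
  obtain ⟨a, ha, ha'⟩ := hR.exists_mem_span_homogeneousOps_eqOn (f.smulRight w) g h
  refine ⟨a, ha, fun v hv => ?_⟩
  rw [ha' v hv, LinearMap.smulRight_apply, map_smul, hR.basis.proj_apply_of_mem hw]

theorem exists_mem_span_homogeneousOps_apply_eq [Finite I] (hR : IsDenseForm 𝒱 R y deg)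
    {g h : G} {v w : V} (hv : v ∈ 𝒱 g) (hv0 : v ≠ 0) (hw : w ∈ 𝒱 h) :
    ∃ a ∈ Submodule.span E (homogeneousOps 𝒱 R (h * g⁻¹) : Set (End E V)), a v = w := by
  obtain ⟨f, hf⟩ := Projective.exists_dual_eq_one E hv0
  obtain ⟨a, ha, ha'⟩ := hR.exists_mem_span_homogeneousOps_eq_smul f hw g
  exact ⟨a, ha, by rw [ha' v hv, hf, one_smul]⟩

end IsDenseForm

end HomogeneousOperators

section AlternatingProducts

open Module

variable {E M A : Type*} [CommRing E] [AddCommGroup M] [Module E M]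

theorem exists_mem_multilinearMap_apply_ne_zero {ι N : Type*} [Finite ι] [AddCommGroup N]
    [Module E N] (f : MultilinearMap E (fun _ : ι => M) N) {s : ι → Set M} {x : ι → M}
    (hx : ∀ i, x i ∈ Submodule.span E (s i)) (h : f x ≠ 0) : ∃ z, (∀ i, z i ∈ s i) ∧ f z ≠ 0 := by
  classical
  have := Fintype.ofFinite ι
  suffices H : ∀ t : Finset ι, ∃ z, (∀ i ∈ t, z i ∈ s i) ∧ (∀ i ∉ t, z i = x i) ∧ f z ≠ 0 by
    obtain ⟨z, hz, -, h⟩ := H Finset.univ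
    exact ⟨z, fun i => hz i (Finset.mem_univ i), h⟩
  intro t
  induction t using Finset.induction_on with
  | empty => exact ⟨x, by simp, by simp, h⟩
  | insert j t hj ih =>
    obtain ⟨z, hz, hzx, h⟩ := ih
    have hzj : z j ∈ Submodule.span E (s j) := hzx j hj ▸ hx j
    obtain ⟨m, hm, hm0⟩ := exists_mem_apply_ne_zero_of_mem_span hzj (f.toLinearMap z j) (by simpa)
    refine ⟨Function.update z j m, fun i hi => ?_, fun i hi => ?_, by simpa using hm0⟩
    · obtain rfl | hij := eq_or_ne i j
      · simpa using hm
      · rw [Function.update_of_ne hij]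
        exact hz i ((Finset.mem_insert.1 hi).resolve_left hij)
    · rw [Finset.mem_insert, not_or] at hi
      rw [Function.update_of_ne hi.1]
      exact hzx i hi.2

variable [Ring A] [Algebra E A] {k : ℕ}

/-- The alternating map sending `x` to the signed sum, over all permutations `σ`, of the ordered
products of the `N i (x (σ i))`. -/
def alternatingProduct (N : Fin k → M →ₗ[E] A) : M [⋀^Fin k]→ₗ[E] A :=
  MultilinearMap.alternatization ((MultilinearMap.mkPiAlgebraFin E k A).compLinearMap N)

theorem alternatingProduct_apply (N : Fin k → M →ₗ[E] A) (x : Fin k → M) :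
    alternatingProduct N x =
      ∑ σ : Equiv.Perm (Fin k), Equiv.Perm.sign σ • (List.ofFn fun i => N i (x (σ i))).prod := by
  simp [alternatingProduct, MultilinearMap.alternatization_apply]

theorem alternatingProduct_apply_of_eq_smul {N : Fin k → M →ₗ[E] A} {x : Fin k → M}
    {C : Matrix (Fin k) (Fin k) E} {a : A} (h : ∀ i j, N i (x j) = C j i • a) :
    alternatingProduct N x = C.det • a ^ k := by
  rw [alternatingProduct_apply, Matrix.det_apply, Finset.sum_smul]
  refine Finset.sum_congr rfl fun σ _ => ?_
  simp_rw [h]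
  rw [← MultilinearMap.mkPiAlgebraFin_apply (R := E), MultilinearMap.map_smul_univ,
    MultilinearMap.mkPiAlgebraFin_apply_const, smul_assoc]

theorem exists_mem_alternatingProduct_ne_zero {N : Fin k → M →ₗ[E] A} {s : Set (M →ₗ[E] A)}
    (hN : ∀ i, N i ∈ Submodule.span E s) {x : Fin k → M} (h : alternatingProduct N x ≠ 0) :
    ∃ N', (∀ i, N' i ∈ s) ∧ alternatingProduct N' x ≠ 0 := by
  let f : MultilinearMap E (fun _ : Fin k => M →ₗ[E] A) A :=
    ∑ σ : Equiv.Perm (Fin k), Equiv.Perm.sign σ •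
      (MultilinearMap.mkPiAlgebraFin E k A).compLinearMap fun i => LinearMap.applyₗ (x (σ i))
  have hf (N) : f N = alternatingProduct N x := by simp [f, alternatingProduct_apply]
  simp only [← hf] at h ⊢
  exact exists_mem_multilinearMap_apply_ne_zero f hN h

theorem alternatingProduct_mem {F : Type*} [CommRing F] [Module F A] {S : NonUnitalSubalgebra F A}
    (hk : k ≠ 0) {N : Fin k → M →ₗ[E] A} {x : Fin k → M} (h : ∀ i j, N i (x j) ∈ S) :
    alternatingProduct N x ∈ S := by
  have hprod {l : List A} (hl : l ≠ []) (hS : ∀ a ∈ l, a ∈ S) : l.prod ∈ S := by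
    induction l with
    | nil => exact absurd rfl hl
    | cons a l ih =>
      obtain ⟨ha, hS⟩ := List.forall_mem_cons.1 hS
      obtain rfl | hl := eq_or_ne l []
      · simpa using ha
      · rw [List.prod_cons]
        exact mul_mem ha (ih hl hS)
  rw [alternatingProduct_apply]
  refine sum_mem fun σ _ => zsmul_mem (hprod ?_ ?_) _
  · simpa [List.ofFn_eq_nil_iff] using hk
  · simpa [List.forall_mem_ofFn_iff] using fun i => h i (σ i)

end AlternatingProducts

section AlternatingOperators

open Module

variable {F E G V I : Type*} [Field F] [Field E] [Algebra F E] [CommGroup G]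
  [NonUnitalNonAssocRing V] [Module F V] [Module E V] [IsScalarTower F E V] [IsScalarTower E V V]
  [SMulCommClass E V V]

/-- The linear families of operators `N v`, `v : V`, which are of neutral degree and in the
multiplication algebra of `R` as soon as `v` is an element of `R` of degree `g`. -/
def neutralFamilies (𝒱 : G → Submodule E V) (R : NonUnitalSubalgebra F V) (g : G) :
    Set (V →ₗ[E] End E V) :=
  {N | ∀ r ∈ R, r ∈ 𝒱 g → N r ∈ neutralOps 𝒱 R}

namespace IsDenseForm

variable {𝒱 : G → Submodule E V} {R : NonUnitalSubalgebra F V} {y : Basis I E V} {deg : I → G}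

theorem mulLeft_comp_mul_comp_mem_span_neutralFamilies (hR : IsDenseForm 𝒱 R y deg) {d d' g : G}
    (hd : d' * (d * g) = 1) {a b : End E V}
    (ha : a ∈ Submodule.span E (homogeneousOps 𝒱 R d : Set (End E V)))
    (hb : b ∈ Submodule.span E (homogeneousOps 𝒱 R d' : Set (End E V))) :
    LinearMap.mulLeft E b ∘ₗ LinearMap.mul E V ∘ₗ a ∈ Submodule.span E (neutralFamilies 𝒱 R g) := by
  let B : End E V →ₗ[E] End E V →ₗ[E] V →ₗ[E] End E V :=
    LinearMap.mk₂ E (fun b a => LinearMap.mulLeft E b ∘ₗ LinearMap.mul E V ∘ₗ a)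
      (fun _ _ _ => by ext; simp) (fun _ _ _ => by ext; simp) (fun _ _ _ => by ext; simp)
      (fun _ _ _ => by ext; simp)
  have hB := Submodule.apply_mem_map₂ B hb ha
  rw [Submodule.map₂_span_span] at hB
  refine Submodule.span_mono ?_ hB
  rintro _ ⟨b, hb, a, ha, rfl⟩ r hr hrg
  have har := hR.mulLeft_mem_homogeneousOps (apply_mem_of_mem_unitalFormMulAlgebra ha.1 hr)
    (ha.2 g r hrg)
  refine ⟨mul_mem_formMulAlgebra_of_left_mem hb.1 (NonUnitalAlgebra.subset_adjoin F
    (Or.inl ⟨a r, apply_mem_of_mem_unitalFormMulAlgebra ha.1 hr, rfl⟩)), fun h v hv => ?_⟩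
  have := (mul_mem_homogeneousOps hb har).2 h v hv
  rwa [hd, one_mul] at this

theorem exists_alternatingMap [Finite I] (hR : IsDenseForm 𝒱 R y deg) {g : G}
    (hg : ∃ i, deg i = g) :
    ∃ f : V [⋀^{i // deg i = g}]→ₗ[E] End E V,
      (∀ x, (∀ i, x i ∈ R ∧ x i ∈ 𝒱 g) → f x ∈ neutralOps 𝒱 R) ∧ f (fun i => y i) ≠ 0 := by
  obtain ⟨p, q, hpq⟩ := exists_basis_mul_ne_zero y hR.mul_ne_zero
  have hp := hR.basis.basis_mem p
  have hq := hR.basis.basis_mem q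
  let s := (Finite.equivFin {i // deg i = g}).symm
  have hs (j) : y (s j) ∈ 𝒱 g := by simpa only [(s j).2] using hR.basis.basis_mem (s j)
  choose a ha hay using fun i => hR.exists_mem_span_homogeneousOps_eq_smul (y.coord (s i)) hp g
  obtain ⟨b, hb, hbq⟩ := hR.exists_mem_span_homogeneousOps_apply_eq (hR.mul_mem hp hq) hpq hq
  let P : End E V := b * LinearMap.mulLeft E (y p)
  have hP (k : ℕ) : (P ^ k) (y q) = y q := by
    have hPq : P (y q) = y q := hbq
    rw [Module.End.pow_apply]
    exact Function.iterate_fixed hPq k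
  have hN (i j) : (LinearMap.mulLeft E b ∘ₗ LinearMap.mul E V ∘ₗ a i) (y (s j)) =
      (1 : Matrix _ _ E) j i • P := by
    ext v
    obtain rfl | hij := eq_or_ne j i
    · simp [hay j _ (hs j), P]
    · simp [hay i _ (hs j), hij, Subtype.coe_ne_coe.2 (s.injective.ne hij)]
  obtain ⟨N, hNs, hN0⟩ := exists_mem_alternatingProduct_ne_zero (x := fun j => y (s j))
    (fun i => hR.mulLeft_comp_mul_comp_mem_span_neutralFamilies (g := g) (by group) (ha i) hb) (by
      rw [alternatingProduct_apply_of_eq_smul hN, Matrix.det_one, one_smul]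
      exact fun h => y.ne_zero q (by rw [← hP, h, LinearMap.zero_apply]))
  refine ⟨(alternatingProduct N).domDomCongr s, fun x hx => ?_, hN0⟩
  obtain ⟨i, hi⟩ := hg
  have : Nonempty {i // deg i = g} := ⟨i, hi⟩
  exact alternatingProduct_mem Nat.card_pos.ne' fun i j => hNs i _ (hx _).1 (hx _).2

end IsDenseForm

end AlternatingOperators

section AlternatingMaps

open Module

variable {E V N ι : Type*} [CommRing E] [AddCommGroup V] [Module E V] [AddCommGroup N] [Module E N]
  [Fintype ι] [DecidableEq ι]

theorem sum_det_updateRow_mul (C D : Matrix ι ι E) :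
    ∑ i, (C.updateRow i ((C * D) i)).det = D.trace * C.det := by
  calc ∑ i, (C.updateRow i ((C * D) i)).det = ((C * D) * C.adjugate).trace := by
        refine Finset.sum_congr rfl fun i _ => ?_
        rw [← Matrix.cramer_transpose_apply, Matrix.cramer_eq_adjugate_mulVec,
          ← Matrix.adjugate_transpose, Matrix.mulVec_transpose]
        rfl
    _ = D.trace * C.det := by
        rw [Matrix.trace_mul_comm, ← Matrix.mul_assoc, Matrix.adjugate_mul, Matrix.smul_mul,
          Matrix.one_mul, Matrix.trace_smul, smul_eq_mul, mul_comm]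

theorem alternatingMap_sum_smul (f : V [⋀^ι]→ₗ[E] N) (C : Matrix ι ι E) (v : ι → V) :
    f (fun i => ∑ j, C i j • v j) = C.det • f v := by
  let L : (ι → E) →ₗ[E] V := Fintype.linearCombination E v
  suffices h : f.compLinearMap L =
      (LinearMap.toSpanSingleton E N (f v)).compAlternatingMap Matrix.detRowAlternating from
    congr($h C)
  refine (Pi.basisFun E ι).ext_alternating fun w hw => ?_
  let σ := Equiv.ofBijective w (Finite.injective_iff_bijective.1 hw)
  have hL (i) : L (Pi.basisFun E ι i) = v i := by simp [L]
  have hdet : Matrix.detRowAlternating (Pi.basisFun E ι) = (1 : E) := by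
    rw [← Matrix.det_one (n := ι) (R := E)]
    congr 1
    ext i j
    simp [Pi.single_apply, Matrix.one_apply, eq_comm]
  change f.compLinearMap L (Pi.basisFun E ι ∘ σ) = LinearMap.compAlternatingMap _ _ (_ ∘ σ)
  rw [AlternatingMap.map_perm, AlternatingMap.map_perm, AlternatingMap.compLinearMap_apply,
    funext hL, LinearMap.compAlternatingMap_apply, hdet, LinearMap.toSpanSingleton_apply, one_smul]

theorem sum_alternatingMap_update_apply (f : V [⋀^ι]→ₗ[E] N) {A : End E V} {v : ι → V}
    {D : Matrix ι ι E} (hA : ∀ i, A (v i) = ∑ j, D i j • v j) {x : ι → V}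
    (hx : ∀ i, x i ∈ Submodule.span E (Set.range v)) :
    ∑ i, f (Function.update x i (A (x i))) = D.trace • f x := by
  choose C hC using fun i => (Submodule.mem_span_range_iff_exists_fun E).1 (hx i)
  have hAx (i) : A (x i) = ∑ j, ((Matrix.of C * D) i j) • v j := by
    simp only [← hC, map_sum, map_smul, hA, Finset.smul_sum, Matrix.mul_apply, Finset.sum_smul,
      smul_smul, Matrix.of_apply]
    exact Finset.sum_comm
  have hup (i) : f (Function.update x i (A (x i))) =
      ((Matrix.of C).updateRow i ((Matrix.of C * D) i)).det • f v := by
    rw [← alternatingMap_sum_smul]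
    congr 1
    funext k
    obtain rfl | hk := eq_or_ne k i
    · simp [hAx]
    · simp [hk, hC]
  have hfx : f x = (Matrix.of C).det • f v := by
    rw [← alternatingMap_sum_smul]
    congr 1
    exact (funext hC).symm
  rw [Finset.sum_congr rfl fun i _ => hup i, ← Finset.sum_smul, sum_det_updateRow_mul, hfx,
    smul_smul]

end AlternatingMaps

section BlockTrace

open Module

variable {E G V I : Type*} [CommRing E] [AddCommGroup V] [Module E V]

/-- The trace of the diagonal block of degree `g` of an operator. -/
def blockTrace (y : Basis I E V) (deg : I → G) (g : G) : End E V →ₗ[E] E :=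
  LinearMap.trace E V ∘ₗ LinearMap.mulLeft E (homogeneousProj y deg g)

open Classical in
theorem repr_homogeneousProj (y : Basis I E V) (deg : I → G) (g : G) (v : V) (i : I) :
    y.repr (homogeneousProj y deg g v) i = if deg i = g then y.repr v i else 0 := by
  suffices h : y.coord i ∘ₗ homogeneousProj y deg g = if deg i = g then y.coord i else 0 by
    have := congr($h v)
    split_ifs at this ⊢ with hi <;> simpa using this
  refine y.ext fun j => ?_
  by_cases hj : deg j = g
  · subst hj
    rw [LinearMap.comp_apply, homogeneousProj_basis_self]
    obtain rfl | hij := eq_or_ne i j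
    · simp
    · split_ifs <;> simp [hij.symm]
  · rw [LinearMap.comp_apply, homogeneousProj_basis_of_ne y hj]
    obtain rfl | hij := eq_or_ne i j
    · simp [hj]
    · split_ifs <;> simp [hij.symm]

open Classical in
theorem blockTrace_eq_sum [Fintype I] (y : Basis I E V) (deg : I → G) (g : G) (A : End E V) :
    blockTrace y deg g A = ∑ i : {i // deg i = g}, y.repr (A (y i)) i := by
  rw [blockTrace, LinearMap.comp_apply, LinearMap.trace_eq_matrix_trace E y, Matrix.trace]
  simp only [Matrix.diag_apply, LinearMap.toMatrix_apply, LinearMap.mulLeft_apply,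
    Module.End.mul_apply, repr_homogeneousProj]
  rw [← Finset.sum_filter, Finset.sum_subtype (p := (deg · = g)) _ (by simp)]

namespace IsHomogeneousBasis

variable {𝒱 : G → Submodule E V} {y : Basis I E V} {deg : I → G} {g : G}

theorem mem_span_range (hy : IsHomogeneousBasis 𝒱 y deg) {v : V} (hv : v ∈ 𝒱 g) :
    v ∈ Submodule.span E (Set.range fun i : {i // deg i = g} => y i) := by
  rwa [hy, Set.image_eq_range] at hv

open Classical in
theorem sum_repr_smul [Fintype I] (hy : IsHomogeneousBasis 𝒱 y deg) {v : V} (hv : v ∈ 𝒱 g) :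
    ∑ i : {i // deg i = g}, y.repr v i • y i = v := by
  rw [← Finset.sum_subtype (Finset.univ.filter (deg · = g)) (by simp) fun i => y.repr v i • y i,
    Finset.sum_filter_of_ne, y.sum_repr]
  intro i _ hi
  by_contra h
  exact hi (by rw [hy.mem_iff.1 hv i h, zero_smul])

open Classical in
theorem sum_alternatingMap_update_apply [Fintype I] {N : Type*} [AddCommGroup N] [Module E N]
    (hy : IsHomogeneousBasis 𝒱 y deg) (f : V [⋀^{i // deg i = g}]→ₗ[E] N) {A : End E V}
    (hA : ∀ v ∈ 𝒱 g, A v ∈ 𝒱 g) {x : {i // deg i = g} → V} (hx : ∀ i, x i ∈ 𝒱 g) :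
    ∑ i, f (Function.update x i (A (x i))) = blockTrace y deg g A • f x := by
  have hAy (i : {i // deg i = g}) : A (y i) = ∑ j : {j // deg j = g}, y.repr (A (y i)) j • y j :=
    (hy.sum_repr_smul (hA _ (by simpa only [i.2] using hy.basis_mem i))).symm
  rw [_root_.sum_alternatingMap_update_apply f (D := .of fun i j => y.repr (A (y i)) j) hAy
    fun i => hy.mem_span_range (hx i), blockTrace_eq_sum]
  rfl

end IsHomogeneousBasis

end BlockTrace

section TraceField

open Module

variable {F E G V I : Type*} [Field F] [Field E] [Algebra F E] [NonUnitalNonAssocRing V]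
  [Module F V] [Module E V] [IsScalarTower F E V] [IsScalarTower E V V] [SMulCommClass E V V]

theorem repr_mem_of_mem_adjoin_range [IsScalarTower F V V] [SMulCommClass F V V]
    {K : IntermediateField F E} {y : Basis I E V}
    (hy : ∀ i j k, y.repr (y i * y j) k ∈ K) {r : V}
    (hr : r ∈ NonUnitalAlgebra.adjoin F (Set.range y)) (k : I) : y.repr r k ∈ K := by
  classical
  induction hr using NonUnitalAlgebra.adjoin_induction generalizing k with
  | mem _ hr =>
    obtain ⟨i, rfl⟩ := hr
    rw [y.repr_self, Finsupp.single_apply]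
    split_ifs
    exacts [one_mem K, zero_mem K]
  | add r s _ _ hr hs =>
    rw [map_add, Finsupp.add_apply]
    exact add_mem (hr k) (hs k)
  | zero =>
    rw [map_zero, Finsupp.zero_apply]
    exact zero_mem K
  | mul r s _ _ hr hs =>
    rw [← y.linearCombination_repr r, ← y.linearCombination_repr s,
      Finsupp.linearCombination_apply, Finsupp.linearCombination_apply, Finsupp.sum, Finsupp.sum,
      Finset.sum_mul_sum]
    simp only [smul_mul_smul_comm, map_sum, map_smul, Finsupp.coe_finsetSum, Finset.sum_apply,
      Finsupp.smul_apply, smul_eq_mul]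
    exact sum_mem fun i _ => sum_mem fun j _ => mul_mem (mul_mem (hr i) (hs j)) (hy i j k)
  | smul c r _ hr =>
    rw [← algebraMap_smul E c r, map_smul, Finsupp.smul_apply, smul_eq_mul]
    exact mul_mem (K.algebraMap_mem c) (hr k)

variable [CommGroup G]

/-- The traces of the diagonal block of degree `g` of the operators of neutral degree in the unital
multiplication algebra of `R`. -/
def neutralTraces (𝒱 : G → Submodule E V) (R : NonUnitalSubalgebra F V) (y : Basis I E V)
    (deg : I → G) (g : G) : Set E :=
  blockTrace y deg g '' homogeneousOps 𝒱 R 1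

/-- The span of the values of the alternating map `f` on the elements of `R` of degree `g`. -/
def alternatingValues {ι : Type*} (𝒱 : G → Submodule E V) (R : NonUnitalSubalgebra F V) (g : G)
    (f : V [⋀^ι]→ₗ[E] End E V) : Submodule F (End E V) :=
  Submodule.span F (f '' {x | ∀ i, x i ∈ R ∧ x i ∈ 𝒱 g})

theorem mem_homogeneousOps_of_mem_neutralOps {𝒱 : G → Submodule E V} {R : NonUnitalSubalgebra F V}
    {m : End E V} (hm : m ∈ neutralOps 𝒱 R) : m ∈ homogeneousOps 𝒱 R 1 :=
  ⟨formMulAlgebra_le_unitalFormMulAlgebra hm.1, fun g v hv => (one_mul g).symm ▸ hm.2 g v hv⟩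

namespace IsDenseForm

variable {𝒱 : G → Submodule E V} {R : NonUnitalSubalgebra F V} {y : Basis I E V} {deg : I → G}
  {g : G}

theorem smul_mem_alternatingValues [Finite I] (hR : IsDenseForm 𝒱 R y deg)
    (f : V [⋀^{i // deg i = g}]→ₗ[E] End E V) {c : E}
    (hc : c ∈ Algebra.adjoin F (neutralTraces 𝒱 R y deg g)) {S : End E V}
    (hS : S ∈ alternatingValues 𝒱 R g f) : c • S ∈ alternatingValues 𝒱 R g f := by
  classical
  have := Fintype.ofFinite I
  induction hc using Algebra.adjoin_induction generalizing S with
  | mem c hc =>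
    obtain ⟨A, hA, rfl⟩ := hc
    have hAg (v) (hv : v ∈ 𝒱 g) : A v ∈ 𝒱 g := by simpa only [one_mul] using hA.2 g v hv
    induction hS using Submodule.span_induction with
    | mem S hS =>
      obtain ⟨x, hx, rfl⟩ := hS
      rw [← hR.basis.sum_alternatingMap_update_apply f hAg fun i => (hx i).2]
      refine sum_mem fun i _ => Submodule.subset_span ⟨_, fun j => ?_, rfl⟩
      obtain rfl | hj := eq_or_ne j i
      · rw [Function.update_self]
        exact ⟨apply_mem_of_mem_unitalFormMulAlgebra hA.1 (hx j).1, hAg _ (hx j).2⟩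
      · rw [Function.update_of_ne hj]
        exact hx j
    | zero =>
      rw [smul_zero]
      exact zero_mem _
    | add S T _ _ hS hT => exact smul_add (blockTrace y deg g A) S T ▸ add_mem hS hT
    | smul c S _ hS => exact smul_comm (blockTrace y deg g A) c S ▸ Submodule.smul_mem _ c hS
  | algebraMap c => exact algebraMap_smul E c S ▸ Submodule.smul_mem _ c hS
  | add c d _ _ hc hd => exact add_smul c d S ▸ add_mem (hc hS) (hd hS)
  | mul c d _ _ hc hd => exact mul_smul c d S ▸ hc (hd hS)

theorem exists_blockTrace_ne_zero [Finite I] (hR : IsDenseForm 𝒱 R y deg) (hg : ∃ i, deg i = g)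
    {S : End E V} (hS : IsNeutralMap 𝒱 S) (hS0 : S ≠ 0) :
    ∃ d, ∃ A ∈ homogeneousOps 𝒱 R d⁻¹, ∃ B ∈ homogeneousOps 𝒱 R d,
      blockTrace y deg g (A * S * B) ≠ 0 := by
  obtain ⟨i, rfl⟩ := hg
  obtain ⟨j, hj⟩ : ∃ j, S (y j) ≠ 0 := by
    by_contra! h
    exact hS0 (y.ext h)
  have hi := hR.basis.basis_mem i
  have hyj := hR.basis.basis_mem j
  obtain ⟨B, hB, hBv⟩ := hR.exists_mem_span_homogeneousOps_eq_smul (y.coord i) hyj (deg i)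
  obtain ⟨A, hA, hAv⟩ := hR.exists_mem_span_homogeneousOps_apply_eq (hS _ _ hyj) hj hi
  have hproj : homogeneousProj y deg (deg i) * (A * S * B) = (y.coord i).smulRight (y i) := by
    refine y.ext fun k => ?_
    by_cases hk : deg k = deg i
    · have hyk := hk ▸ hR.basis.basis_mem k
      simp [hBv _ hyk, hAv, homogeneousProj_basis_self]
    · have hki : k ≠ i := fun h => hk (h ▸ rfl)
      have hmem := isHomogeneousMap_of_mem_span hA _ _
        (hS _ _ (isHomogeneousMap_of_mem_span hB _ _ (hR.basis.basis_mem k)))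
      have := hR.basis.proj_apply_of_mem_of_ne hmem (h := deg i) (by group; exact hk)
      simp [this, hki]
  have := Module.Finite.of_basis y
  have htrace : blockTrace y deg (deg i) (A * S * B) ≠ 0 := by
    rw [blockTrace, LinearMap.comp_apply, LinearMap.mulLeft_apply, hproj,
      LinearMap.trace_smulRight, Basis.coord_apply, Basis.repr_self, Finsupp.single_eq_same]
    exact one_ne_zero
  obtain ⟨A, hA, htrace⟩ := exists_mem_apply_ne_zero_of_mem_span hA
    (blockTrace y deg (deg i) ∘ₗ LinearMap.mulRight E (S * B)) (by simpa [mul_assoc] using htrace)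
  obtain ⟨B, hB, htrace⟩ := exists_mem_apply_ne_zero_of_mem_span hB
    (blockTrace y deg (deg i) ∘ₗ LinearMap.mulLeft E (A * S)) (by simpa [mul_assoc] using htrace)
  exact ⟨_, A, by simpa using hA, B, hB, htrace⟩

theorem mem_adjoin_neutralTraces_of_smul_mem [Finite I] (hR : IsDenseForm 𝒱 R y deg)
    (hg : ∃ i, deg i = g) {S : End E V} (hS : S ∈ neutralOps 𝒱 R) (hS0 : S ≠ 0) {c : E}
    (hc : c • S ∈ neutralOps 𝒱 R) :
    c ∈ IntermediateField.adjoin F (neutralTraces 𝒱 R y deg g) := by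
  obtain ⟨d, A, hA, B, hB, htrace⟩ := hR.exists_blockTrace_ne_zero hg hS.2 hS0
  have hmem {T : End E V} (hT : T ∈ neutralOps 𝒱 R) : blockTrace y deg g (A * T * B) ∈
      IntermediateField.adjoin F (neutralTraces 𝒱 R y deg g) := by
    refine IntermediateField.subset_adjoin F _ ⟨_, ?_, rfl⟩
    have := mul_mem_homogeneousOps (mul_mem_homogeneousOps hA
      (mem_homogeneousOps_of_mem_neutralOps hT)) hB
    rwa [mul_one, inv_mul_cancel] at this
  have hcS : blockTrace y deg g (A * c • S * B) = c * blockTrace y deg g (A * S * B) := by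
    rw [mul_smul_comm, smul_mul_assoc, map_smul, smul_eq_mul]
  rw [eq_div_of_mul_eq htrace hcS.symm]
  exact div_mem (hmem hc) (hmem hS)

open Classical in
theorem repr_mem_adjoin_neutralTraces_of_mem [Finite I] (hR : IsDenseForm 𝒱 R y deg)
    (hg : ∃ i, deg i = g) {h : G} {r : V} (hr : r ∈ R) (hrh : r ∈ 𝒱 h) (i : I) :
    y.repr r i ∈ IntermediateField.adjoin F (neutralTraces 𝒱 R y deg g) := by
  have := Fintype.ofFinite I
  by_cases hi : deg i = h
  · obtain ⟨f, hf, hf0⟩ := hR.exists_alternatingMap ⟨i, hi⟩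
    let x : {i // deg i = h} → V := fun i => y i
    have hx (j) : x j ∈ R ∧ x j ∈ 𝒱 h :=
      ⟨hR.basis_mem j, by simpa only [j.2] using hR.basis.basis_mem j⟩
    have hfr : f (Function.update x ⟨i, hi⟩ r) = y.repr r i • f x := by
      rw [← hR.basis.sum_repr_smul hrh, f.map_update_sum, Finset.sum_eq_single ⟨i, hi⟩]
      · rw [f.map_update_smul, Function.update_eq_self_iff.2 rfl, hR.basis.sum_repr_smul hrh]
      · intro j _ hj
        rw [f.map_update_smul, f.map_update_self x hj.symm, smul_zero]
      · simp
    refine hR.mem_adjoin_neutralTraces_of_smul_mem hg (hf x hx) hf0 (hfr ▸ hf _ fun j => ?_)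
    obtain rfl | hj := eq_or_ne j ⟨i, hi⟩
    · rw [Function.update_self]
      exact ⟨hr, hrh⟩
    · rw [Function.update_of_ne hj]
      exact hx j
  · rw [hR.basis.mem_iff.1 hrh i hi]
    exact zero_mem _

theorem repr_mem_adjoin_neutralTraces [IsScalarTower F V V] [SMulCommClass F V V] [Finite I]
    (hR : IsDenseForm 𝒱 R y deg) (hgen : R = NonUnitalAlgebra.adjoin F (Set.range y))
    (hg : ∃ i, deg i = g) {r : V} (hr : r ∈ R) (i : I) :
    y.repr r i ∈ IntermediateField.adjoin F (neutralTraces 𝒱 R y deg g) := by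
  refine repr_mem_of_mem_adjoin_range (fun i j => hR.repr_mem_adjoin_neutralTraces_of_mem hg
    (h := deg i * deg j) (MulMemClass.mul_mem (hR.basis_mem i) (hR.basis_mem j))
    (hR.mul_mem ?_ ?_)) (hgen ▸ hr) i
  exacts [hR.basis.basis_mem i, hR.basis.basis_mem j]

end IsDenseForm

end TraceField

section Descent

open Module

theorem mem_span_of_mem_span_of_mem_span_range {K E W J : Type*} [Field K] [Field E] [Algebra K E]
    [AddCommGroup W] [Module E W] [Module K W] [IsScalarTower K E W] (b : Basis J E W) {s : Set W}
    (hs : s ⊆ Submodule.span K (Set.range b)) {x : W} (hxs : x ∈ Submodule.span E s)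
    (hxb : x ∈ Submodule.span K (Set.range b)) : x ∈ Submodule.span K s := by
  obtain ⟨ρ, hρ⟩ := (Algebra.linearMap K E).exists_leftInverse_of_injective
    (LinearMap.ker_eq_bot.2 (algebraMap K E).injective)
  have hρ1 : ρ 1 = 1 := by simpa using congr($hρ 1)
  let P : W →ₗ[K] W := Finsupp.linearCombination K b ∘ₗ Finsupp.mapRange.linearMap ρ ∘ₗ
    b.repr.toLinearMap.restrictScalars K
  have hP (c : E) : ∀ x ∈ Submodule.span K (Set.range b), P (c • x) = ρ c • x := by
    refine LinearMap.eqOn_span (f := P ∘ₗ (LinearMap.lsmul E W c).restrictScalars K)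
      (g := ρ c • LinearMap.id) ?_
    rintro _ ⟨i, rfl⟩
    simp [P]
  have hPs : ∀ z ∈ Submodule.span E s, ∀ c : E, P (c • z) ∈ Submodule.span K s := by
    intro z hz
    induction hz using Submodule.span_induction with
    | mem z hz => exact fun c => hP c z (hs hz) ▸ Submodule.smul_mem _ _ (Submodule.subset_span hz)
    | zero => simp
    | add z w _ _ hz hw => exact fun c => by rw [smul_add, map_add]; exact add_mem (hz c) (hw c)
    | smul d z _ hz => exact fun c => by rw [smul_smul]; exact hz (c * d)
  have := hPs x hxs 1
  rwa [hP 1 x hxb, hρ1, one_smul] at this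

theorem repr_end_apply {E V I : Type*} [CommRing E] [AddCommGroup V] [Module E V] [Fintype I]
    [DecidableEq I] (y : Basis I E V) (T : End E V) (p : I × I) :
    y.end.repr T p = y.repr (T (y p.2)) p.1 := by
  suffices h : y.end.coord p = y.coord p.1 ∘ₗ LinearMap.applyₗ (y p.2) from congr($h T)
  refine y.end.ext fun q => ?_
  rw [LinearMap.comp_apply, LinearMap.applyₗ_apply_apply, Basis.end_apply_apply]
  obtain ⟨i, j⟩ := p
  obtain ⟨k, l⟩ := q
  by_cases h : l = j <;> simp [h, Finsupp.single_apply]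

end Descent

section FormField

open Module
open scoped Pointwise

theorem mul_mem_of_mem_adjoin {F E : Type*} [CommRing F] [CommRing E] [Algebra F E]
    {N : NonUnitalSubalgebra F E} {r q : E} (hr : r ∈ Algebra.adjoin F (N : Set E)) (hq : q ∈ N) :
    r * q ∈ N := by
  induction hr using Algebra.adjoin_induction generalizing q with
  | mem r hr => exact mul_mem hr hq
  | algebraMap c => exact Algebra.smul_def c q ▸ SMulMemClass.smul_mem c hq
  | add r s _ _ hr hs => exact add_mul r s q ▸ add_mem (hr hq) (hs hq)
  | mul r s _ _ hr hs => exact mul_assoc r s q ▸ hr (hs hq)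

theorem mem_adjoin_iff_exists_mul_mem {F E : Type*} [Field F] [Field E] [Algebra F E]
    {N : NonUnitalSubalgebra F E} (hN : ∃ q ∈ N, q ≠ 0) {x : E} :
    x ∈ IntermediateField.adjoin F (N : Set E) ↔ ∃ p ∈ N, p ≠ 0 ∧ x * p ∈ N := by
  constructor
  · intro hx
    obtain ⟨q, hq, hq0⟩ := hN
    obtain ⟨r, hr, s, hs, rfl⟩ := IntermediateField.mem_adjoin_iff_div.1 hx
    obtain rfl | hs0 := eq_or_ne s 0
    · exact ⟨q, hq, hq0, by simp⟩
    · refine ⟨s * q, mul_mem_of_mem_adjoin hs hq, mul_ne_zero hs0 hq0, ?_⟩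
      rw [← mul_assoc, div_mul_cancel₀ r hs0]
      exact mul_mem_of_mem_adjoin hr hq
  · rintro ⟨p, hp, hp0, hxp⟩
    rw [eq_div_of_mul_eq hp0 (Eq.refl (x * p))]
    exact div_mem (IntermediateField.subset_adjoin F _ hxp) (IntermediateField.subset_adjoin F _ hp)

theorem exists_mul_mem_of_mem_adjoin {F E I : Type*} [Field F] [Field E] [Algebra F E] [Finite I]
    {N : NonUnitalSubalgebra F E} (hN : ∃ q ∈ N, q ≠ 0) {f : I → E}
    (hf : ∀ i, f i ∈ IntermediateField.adjoin F (N : Set E)) :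
    ∃ p ∈ N, p ≠ 0 ∧ ∀ i, f i * p ∈ N := by
  classical
  have := Fintype.ofFinite I
  obtain ⟨q, hq, hq0⟩ := hN
  choose p hp hp0 hfp using fun i => (mem_adjoin_iff_exists_mul_mem ⟨q, hq, hq0⟩).1 (hf i)
  have hprod (s : Finset I) : ∏ i ∈ s, p i ∈ Algebra.adjoin F (N : Set E) :=
    prod_mem fun i _ => Algebra.subset_adjoin (hp i)
  refine ⟨(∏ i, p i) * q, mul_mem_of_mem_adjoin (hprod _) hq,
    mul_ne_zero (Finset.prod_ne_zero_iff.2 fun i _ => hp0 i) hq0, fun i => ?_⟩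
  rw [← Finset.mul_prod_erase _ p (Finset.mem_univ i), ← mul_assoc, ← mul_assoc, mul_assoc (_ * _),
    mul_comm]
  exact mul_mem (mul_mem_of_mem_adjoin (hprod _) hq) (hfp i)

variable {F E G V I : Type*} [Field F] [Field E] [Algebra F E] [NonUnitalNonAssocRing V]
  [Module F V] [Module E V] [IsScalarTower F E V] [IsScalarTower E V V] [SMulCommClass E V V]

variable (E) in
/-- The scalars of `E` that act on `V` as elements of the multiplication algebra of `R`. -/
def formScalars (R : NonUnitalSubalgebra F V) : NonUnitalSubalgebra F E :=
  (formMulAlgebra E R).comap ((Algebra.ofId E (End E V)).restrictScalars F)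

theorem mem_formScalars {R : NonUnitalSubalgebra F V} {c : E} :
    c ∈ formScalars E R ↔ c • (1 : End E V) ∈ formMulAlgebra E R := by
  rw [← Algebra.algebraMap_eq_smul_one]
  rfl

variable (E) in
/-- The field generated by the scalars in the multiplication algebra of `R`. -/
def formField (R : NonUnitalSubalgebra F V) : IntermediateField F E :=
  IntermediateField.adjoin F (formScalars E R : Set E)

variable (E) in
/-- The operators `a * Φ * b` with `a` and `b` in the unital multiplication algebra of `R`. -/
def sandwiches (R : NonUnitalSubalgebra F V) (Φ : End E V) : Set (End E V) :=
  unitalFormMulAlgebra E R * {Φ} * unitalFormMulAlgebra E R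

theorem mul_mem_span_sandwiches {R : NonUnitalSubalgebra F V} {Φ S T : End E V}
    (hΦ : Φ ∈ unitalFormMulAlgebra E R) (hS : S ∈ Submodule.span E (sandwiches E R Φ))
    (hT : T ∈ Submodule.span E (sandwiches E R Φ)) :
    S * T ∈ Submodule.span E (sandwiches E R Φ) := by
  have h := Submodule.mul_mem_mul hS hT
  rw [Submodule.span_mul_span] at h
  refine Submodule.span_mono ?_ h
  rintro _ ⟨_, ⟨_, ⟨a, ha, _, rfl, rfl⟩, b, hb, rfl⟩, _, ⟨_, ⟨c, hc, _, rfl, rfl⟩, d, hd, rfl⟩, rfl⟩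
  exact ⟨_, ⟨a, ha, _, rfl, rfl⟩, _, mul_mem (mul_mem (mul_mem hb hc) hΦ) hd, by
    simp only [mul_assoc]⟩

variable (E) in
/-- The operators that some nonzero ideal of the ring generated by `A` multiplies into the
multiplication algebra of `R`. -/
def clearableOps (R : NonUnitalSubalgebra F V) (A : Set E) :
    Submodule (IntermediateField.adjoin F A) (End E V) where
  carrier := {S | ∃ t ∈ Algebra.adjoin F A, t ≠ 0 ∧
    ∀ s ∈ Algebra.adjoin F A, (s * t) • S ∈ formMulAlgebra E R}
  zero_mem' := ⟨1, one_mem _, one_ne_zero, fun s _ => by rw [smul_zero]; exact zero_mem _⟩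
  add_mem' := by
    rintro S T ⟨t, ht, ht0, htS⟩ ⟨u, hu, hu0, huT⟩
    refine ⟨t * u, mul_mem ht hu, mul_ne_zero ht0 hu0, fun s hs => ?_⟩
    rw [smul_add, ← mul_assoc]
    refine add_mem ?_ (huT _ (mul_mem hs ht))
    rw [mul_right_comm]
    exact htS _ (mul_mem hs hu)
  smul_mem' := by
    rintro ⟨c, hc⟩ S ⟨t, ht, ht0, htS⟩
    obtain ⟨p, hp, q, hq, rfl⟩ := IntermediateField.mem_adjoin_iff_div.1 hc
    obtain rfl | hq0 := eq_or_ne q 0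
    · refine ⟨t, ht, ht0, fun s _ => ?_⟩
      simp only [IntermediateField.smul_def, div_zero, zero_smul, smul_zero, zero_mem]
    · refine ⟨q * t, mul_mem hq ht, mul_ne_zero hq0 ht0, fun s hs => ?_⟩
      rw [IntermediateField.smul_def, smul_smul,
        show s * (q * t) * (p / q) = s * p * t by field_simp]
      exact htS _ (mul_mem hs hp)

variable [CommGroup G]

namespace IsDenseForm

variable {𝒱 : G → Submodule E V} {R : NonUnitalSubalgebra F V} {y : Basis I E V} {deg : I → G}
  {g : G}

theorem exists_mem_span_sandwiches_eqOn_id [Finite I] (hR : IsDenseForm 𝒱 R y deg) {Φ : End E V}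
    (hΦ : Φ ∈ neutralOps 𝒱 R) (hΦ0 : Φ ≠ 0) (h : G) :
    ∃ T ∈ Submodule.span E (sandwiches E R Φ), IsNeutralMap 𝒱 T ∧ ∀ v ∈ 𝒱 h, T v = v := by
  classical
  have := Fintype.ofFinite I
  obtain ⟨k, hk⟩ : ∃ k, Φ (y k) ≠ 0 := by
    by_contra! h
    exact hΦ0 (y.ext h)
  have hyk := hR.basis.basis_mem k
  choose b hb hbv using fun i : {i // deg i = h} =>
    hR.exists_mem_span_homogeneousOps_eq_smul (y.coord i) hyk h
  choose a ha hav using fun i : {i // deg i = h} => hR.exists_mem_span_homogeneousOps_apply_eq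
    (hΦ.2 _ _ hyk) hk (hR.basis.basis_mem i)
  have hmid : Φ ∈ Submodule.span E (homogeneousOps 𝒱 R 1 : Set (End E V)) :=
    Submodule.subset_span (mem_homogeneousOps_of_mem_neutralOps hΦ)
  have hops (d : G) : Submodule.span E (homogeneousOps 𝒱 R d : Set (End E V)) ≤
      Submodule.span E (unitalFormMulAlgebra E R : Set (End E V)) :=
    Submodule.span_mono fun m hm => hm.1
  refine ⟨∑ i, a i * Φ * b i, sum_mem fun i _ => ?_, fun g v hv => ?_, fun v hv => ?_⟩
  · rw [sandwiches, ← Submodule.span_mul_span, ← Submodule.span_mul_span]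
    exact Submodule.mul_mem_mul (Submodule.mul_mem_mul (hops _ (ha i))
      (Submodule.mem_span_singleton_self Φ)) (hops _ (hb i))
  · rw [LinearMap.sum_apply]
    refine sum_mem fun i _ => ?_
    have := isHomogeneousMap_of_mem_span
      (mul_mem_span_homogeneousOps (mul_mem_span_homogeneousOps (ha i) hmid) (hb i)) g v hv
    rwa [mul_one, i.2, show h * (deg k)⁻¹ * (deg k * h⁻¹) * g = g by group] at this
  · rw [LinearMap.sum_apply]
    conv_rhs => rw [← hR.basis.sum_repr_smul hv]
    refine Finset.sum_congr rfl fun i _ => ?_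
    rw [Module.End.mul_apply, Module.End.mul_apply, hbv i v hv, map_smul, map_smul, hav,
      Basis.coord_apply]

theorem one_mem_span_sandwiches [Finite I] (hR : IsDenseForm 𝒱 R y deg) {Φ : End E V}
    (hΦ : Φ ∈ neutralOps 𝒱 R) (hΦ0 : Φ ≠ 0) :
    (1 : End E V) ∈ Submodule.span E (sandwiches E R Φ) := by
  classical
  have := Fintype.ofFinite I
  have hglue (s : Finset G) :
      ∃ T ∈ Submodule.span E (sandwiches E R Φ), ∀ h ∈ s, ∀ v ∈ 𝒱 h, T v = v := by
    induction s using Finset.induction_on with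
    | empty => exact ⟨0, zero_mem _, by simp⟩
    | insert h s _ ih =>
      obtain ⟨T, hT, hTv⟩ := ih
      obtain ⟨S, hS, hSn, hSv⟩ := hR.exists_mem_span_sandwiches_eqOn_id hΦ hΦ0 h
      refine ⟨S + T - T * S, sub_mem (add_mem hS hT) (mul_mem_span_sandwiches
        (formMulAlgebra_le_unitalFormMulAlgebra hΦ.1) hT hS), fun h' hh' v hv => ?_⟩
      obtain rfl | hh' := Finset.mem_insert.1 hh'
      · simp [hSv v hv]
      · simp [hTv h' hh' v hv, hTv h' hh' _ (hSn h' v hv)]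
  obtain ⟨T, hT, hTv⟩ := hglue (Finset.univ.image deg)
  have hT1 : T = 1 := y.ext fun i => hTv _ (Finset.mem_image_of_mem _ (Finset.mem_univ i)) _
    (hR.basis.basis_mem i)
  exact hT1 ▸ hT

theorem one_mem_span_sandwiches_of_repr_mem [Finite I] (hR : IsDenseForm 𝒱 R y deg)
    {K : IntermediateField F E} (hK : ∀ r ∈ R, ∀ i, y.repr r i ∈ K) {Φ : End E V}
    (hΦ : Φ ∈ neutralOps 𝒱 R) (hΦ0 : Φ ≠ 0) :
    (1 : End E V) ∈ Submodule.span K (sandwiches E R Φ) := by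
  classical
  have := Fintype.ofFinite I
  have hspan {T : End E V} (hT : T ∈ unitalFormMulAlgebra E R) :
      T ∈ Submodule.span K (Set.range y.end) := by
    rw [← y.end.sum_repr T]
    refine sum_mem fun p _ => Submodule.smul_mem _ (⟨_, ?_⟩ : K)
      (Submodule.subset_span ⟨p, rfl⟩)
    rw [repr_end_apply]
    exact hK _ (apply_mem_of_mem_unitalFormMulAlgebra hT (hR.basis_mem p.2)) p.1
  refine mem_span_of_mem_span_of_mem_span_range y.end ?_ (hR.one_mem_span_sandwiches hΦ hΦ0)
    (hspan (one_mem _))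
  rintro _ ⟨_, ⟨a, ha, _, rfl, rfl⟩, b, hb, rfl⟩
  have hΦ' := formMulAlgebra_le_unitalFormMulAlgebra hΦ.1
  exact hspan (MulMemClass.mul_mem (MulMemClass.mul_mem ha hΦ') hb)

theorem exists_mul_mem_formScalars [IsScalarTower F V V] [SMulCommClass F V V] [Finite I]
    (hR : IsDenseForm 𝒱 R y deg) (hgen : R = NonUnitalAlgebra.adjoin F (Set.range y))
    (hg : ∃ i, deg i = g) :
    ∃ t ≠ 0, ∀ s ∈ Algebra.adjoin F (neutralTraces 𝒱 R y deg g), s * t ∈ formScalars E R := by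
  classical
  have := Fintype.ofFinite I
  obtain ⟨f, hf, hf0⟩ := hR.exists_alternatingMap hg
  have hmem (i : {i // deg i = g}) : y i ∈ R ∧ y i ∈ 𝒱 g :=
    ⟨hR.basis_mem i, by simpa only [i.2] using hR.basis.basis_mem i⟩
  have hle : Submodule.span _ (sandwiches E R (f fun i => y i)) ≤
      clearableOps E R (neutralTraces 𝒱 R y deg g) := by
    refine Submodule.span_le.2 ?_
    rintro _ ⟨_, ⟨a, ha, _, rfl, rfl⟩, b, hb, rfl⟩
    refine ⟨1, one_mem _, one_ne_zero, fun s hs => ?_⟩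
    have hsf : s • f (fun i => y i) ∈ formMulAlgebra E R := by
      have := hR.smul_mem_alternatingValues f hs (Submodule.subset_span ⟨_, hmem, rfl⟩)
      refine Submodule.span_le (p := (formMulAlgebra E R).toSubmodule).2 ?_ this
      rintro _ ⟨x, hx, rfl⟩
      exact (hf x hx).1
    rw [mul_one, ← smul_mul_assoc, ← mul_smul_comm]
    exact mul_mem_formMulAlgebra_of_right_mem (mul_mem_formMulAlgebra_of_left_mem ha hsf) hb
  obtain ⟨t, -, ht0, ht⟩ := hle (hR.one_mem_span_sandwiches_of_repr_mem
    (fun _ hr => hR.repr_mem_adjoin_neutralTraces hgen hg hr) (hf _ hmem) hf0)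
  exact ⟨t, ht0, fun s hs => mem_formScalars.2 (ht s hs)⟩

theorem exists_mem_formScalars_ne_zero [IsScalarTower F V V] [SMulCommClass F V V] [Finite I]
    (hR : IsDenseForm 𝒱 R y deg) (hgen : R = NonUnitalAlgebra.adjoin F (Set.range y)) :
    ∃ c ∈ formScalars E R, c ≠ 0 := by
  obtain ⟨i, -⟩ := exists_basis_mul_ne_zero y hR.mul_ne_zero
  obtain ⟨t, ht0, ht⟩ := hR.exists_mul_mem_formScalars hgen ⟨i, rfl⟩
  exact ⟨t, one_mul t ▸ ht 1 (one_mem _), ht0⟩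

theorem repr_mem_formField [IsScalarTower F V V] [SMulCommClass F V V] [Finite I]
    (hR : IsDenseForm 𝒱 R y deg) (hgen : R = NonUnitalAlgebra.adjoin F (Set.range y)) {r : V}
    (hr : r ∈ R) (i : I) : y.repr r i ∈ formField E R := by
  obtain ⟨t, ht0, ht⟩ := hR.exists_mul_mem_formScalars hgen ⟨i, rfl⟩
  refine IntermediateField.adjoin_le_iff.2 (fun s hs => ?_)
    (hR.repr_mem_adjoin_neutralTraces hgen ⟨i, rfl⟩ hr i)
  refine (mem_adjoin_iff_exists_mul_mem (hR.exists_mem_formScalars_ne_zero hgen)).2 ?_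
  exact ⟨t, one_mul t ▸ ht 1 (one_mem _), ht0, ht s (Algebra.subset_adjoin hs)⟩

end IsDenseForm

end FormField

section StandardIdentity

open Module

/-- The standard polynomial `∑ σ, sign σ • X (σ 0) * ⋯ * X (σ (N - 1))`, the identity satisfied
by every algebra of dimension less than `N`. -/
def standardPolynomial (F : Type*) [Field F] (N : ℕ) : FreeAlgebra F ℕ :=
  ∑ σ : Equiv.Perm (Fin N), ((Equiv.Perm.sign σ : ℤ) : F) •
    FreeMonoid.lift (FreeAlgebra.ι F) (FreeMonoid.ofList (List.ofFn fun i => (σ i : ℕ)))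

theorem standardPolynomial_ne_zero (F : Type*) [Field F] (N : ℕ) :
    standardPolynomial F N ≠ 0 := by
  have hinj : Function.Injective
      fun σ : Equiv.Perm (Fin N) => FreeMonoid.ofList (List.ofFn fun i => (σ i : ℕ)) :=
    fun σ τ h => Equiv.ext fun i =>
      Fin.ext (congrFun (List.ofFn_injective (FreeMonoid.ofList.injective h)) i)
  let b := (MonoidAlgebra.basis (FreeMonoid ℕ) F).map
    FreeAlgebra.equivMonoidAlgebraFreeMonoid.symm.toLinearEquiv
  have hb (w : FreeMonoid ℕ) : b w = FreeMonoid.lift (FreeAlgebra.ι F) w := by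
    simp [b, FreeAlgebra.equivMonoidAlgebraFreeMonoid]
  intro h
  simp only [standardPolynomial, ← hb] at h
  simpa using Fintype.linearIndependent_iff.1 (b.linearIndependent.comp _ hinj) _ h 1

theorem lift_standardPolynomial_eq_zero {F E W : Type*} [Field F] [Field E] [Ring W] [Algebra E W]
    [Algebra F W] [FiniteDimensional E W] (m : ℕ → W) :
    FreeAlgebra.lift F m (standardPolynomial F (finrank E W + 1)) = 0 := by
  have hdep : ¬ LinearIndependent E fun i : Fin (finrank E W + 1) => m i := fun hli => by
    simpa using hli.fintype_card_le_finrank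
  have h := AlternatingMap.map_linearDependent (MultilinearMap.alternatization
    (MultilinearMap.mkPiAlgebraFin E (finrank E W + 1) W)) _ hdep
  rw [MultilinearMap.alternatization_apply] at h
  rw [standardPolynomial, map_sum, ← h]
  refine Finset.sum_congr rfl fun σ _ => ?_
  simp [FreeMonoid.lift_apply, map_list_prod, List.map_ofFn, Function.comp_def,
    Units.smul_def, Int.cast_smul_eq_zsmul]

end StandardIdentity

section Intertwining

open Module

variable {F E A V : Type*} [Field F] [Field E] [Algebra F E] [NonUnitalNonAssocRing A] [Module F A]
  [NonUnitalNonAssocRing V] [Module F V] [Module E V] [IsScalarTower F E V]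

variable (E) in
/-- The pairs of an operator on `A` and an operator on `V` that are intertwined by `i`. -/
def intertwinedOps (i : A →ₙₐ[F] V) : Subalgebra F (End F A × End E V) where
  carrier := {p | ∀ a, i (p.1 a) = p.2 (i a)}
  add_mem' hp hq a := by simp [hp a, hq a]
  mul_mem' hp hq a := by simp [hp (_ : A), hq a]
  algebraMap_mem' c a := by simp [algebraMap_end_apply]

theorem apply_lift_eq_lift_apply {ι : Type*} (i : A →ₙₐ[F] V) {m : ι → End F A} {T : ι → End E V}
    (h : ∀ k a, i (m k a) = T k (i a)) (f : FreeAlgebra F ι) (a : A) :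
    i (FreeAlgebra.lift F m f a) = FreeAlgebra.lift F T f (i a) := by
  have hf : FreeAlgebra.lift F (fun k => (m k, T k)) f ∈ intertwinedOps E i := by
    induction f using FreeAlgebra.induction with
    | grade0 c => simp only [AlgHom.commutes, algebraMap_mem]
    | grade1 k => rw [FreeAlgebra.lift_ι_apply]; exact h k
    | add f g hf hg => rw [map_add]; exact add_mem hf hg
    | mul f g hf hg => rw [map_mul]; exact mul_mem hf hg
  have hfst : (AlgHom.fst F _ _).comp (FreeAlgebra.lift F fun k => (m k, T k)) =
      FreeAlgebra.lift F m := FreeAlgebra.hom_ext (by ext; simp)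
  have hsnd : (AlgHom.snd F _ _).comp (FreeAlgebra.lift F fun k => (m k, T k)) =
      FreeAlgebra.lift F T := FreeAlgebra.hom_ext (by ext; simp)
  rw [← hfst, ← hsnd]
  exact hf a

variable [IsScalarTower F A A] [SMulCommClass F A A] [IsScalarTower E V V] [SMulCommClass E V V]

theorem exists_mem_formMulAlgebra (i : A →ₙₐ[F] V) {m : End F A} (hm : m ∈ mulAlgebra F A) :
    ∃ T ∈ formMulAlgebra E (NonUnitalAlgHom.range i), ∀ a, i (m a) = T (i a) := by
  suffices h : mulAlgebra F A ≤ ((intertwinedOps E i).toNonUnitalSubalgebra ⊓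
      (formMulAlgebra E (NonUnitalAlgHom.range i)).comap (NonUnitalAlgHom.snd F _ _)).map
      (NonUnitalAlgHom.fst F _ _) by
    obtain ⟨⟨_, T⟩, ⟨hT, hmT⟩, rfl⟩ := h hm
    exact ⟨T, hmT, hT⟩
  refine NonUnitalAlgebra.adjoin_le ?_
  rintro _ (⟨a, rfl⟩ | ⟨a, rfl⟩)
  · exact ⟨(LinearMap.mulLeft F a, LinearMap.mulLeft E (i a)), ⟨fun b => map_mul i a b,
      NonUnitalAlgebra.subset_adjoin F (Or.inl ⟨_, ⟨a, rfl⟩, rfl⟩)⟩, rfl⟩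
  · exact ⟨(LinearMap.mulRight F a, LinearMap.mulRight E (i a)), ⟨fun b => map_mul i b a,
      NonUnitalAlgebra.subset_adjoin F (Or.inr ⟨_, ⟨a, rfl⟩, rfl⟩)⟩, rfl⟩

theorem exists_mem_mulAlgebra (i : A →ₙₐ[F] V) {T : End E V}
    (hT : T ∈ formMulAlgebra E (NonUnitalAlgHom.range i)) :
    ∃ m ∈ mulAlgebra F A, ∀ a, i (m a) = T (i a) := by
  suffices h : formMulAlgebra E (NonUnitalAlgHom.range i) ≤
      ((intertwinedOps E i).toNonUnitalSubalgebra ⊓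
        (mulAlgebra F A).comap (NonUnitalAlgHom.fst F _ _)).map (NonUnitalAlgHom.snd F _ _) by
    obtain ⟨⟨m, _⟩, ⟨hm, hmT⟩, rfl⟩ := h hT
    exact ⟨m, hmT, hm⟩
  refine NonUnitalAlgebra.adjoin_le ?_
  rintro _ (⟨_, ⟨a, rfl⟩, rfl⟩ | ⟨_, ⟨a, rfl⟩, rfl⟩)
  · exact ⟨(LinearMap.mulLeft F a, LinearMap.mulLeft E (i a)),
      ⟨fun b => map_mul i a b, mulLeft_mem_mulAlgebra a⟩, rfl⟩
  · exact ⟨(LinearMap.mulRight F a, LinearMap.mulRight E (i a)),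
      ⟨fun b => map_mul i b a, mulRight_mem_mulAlgebra a⟩, rfl⟩

theorem satisfiesPI_of_injective [FiniteDimensional E V] {i : A →ₙₐ[F] V}
    (hi : Function.Injective i) : SatisfiesPI (mulAlgebra F A) := by
  refine ⟨standardPolynomial F (finrank E (End E V) + 1), standardPolynomial_ne_zero _ _,
    fun m hm => LinearMap.ext fun a => hi ?_⟩
  choose T _ hT using fun k => exists_mem_formMulAlgebra (E := E) i (hm k)
  rw [apply_lift_eq_lift_apply i hT, lift_standardPolynomial_eq_zero (E := E),
    LinearMap.zero_apply, LinearMap.zero_apply, map_zero]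

end Intertwining

section GradedForm

open Module

theorem IsDenseForm.exists_eq_smul {F E G V I : Type*} [Field F] [Field E] [CommGroup G]
    [NonUnitalNonAssocRing V] [Module F V] [Module E V] [IsScalarTower E V V] [SMulCommClass E V V]
    {𝒱 : G → Submodule E V} {y : Basis I E V} {deg : I → G} {R : NonUnitalSubalgebra F V}
    (hR : IsDenseForm 𝒱 R y deg) {T : End E V} (hT : IsNeutralMap 𝒱 T)
    (hl : ∀ k l, T (y k * y l) = y k * T (y l)) (hr : ∀ k l, T (y k * y l) = T (y k) * y l) :
    ∃ c : E, ∀ v, T v = c • v := by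
  have hL : (LinearMap.mul E V).compr₂ T = (LinearMap.mul E V).compl₂ T :=
    y.ext fun k => y.ext fun l => hl k l
  have hR' : (LinearMap.mul E V).compr₂ T = LinearMap.mul E V ∘ₗ T :=
    y.ext fun k => y.ext fun l => hr k l
  have hproj (g : G) : homogeneousProj y deg g * T = T * homogeneousProj y deg g := by
    refine y.ext fun l => ?_
    rw [Module.End.mul_apply, Module.End.mul_apply]
    have hyl := hR.basis.basis_mem l
    obtain rfl | hg := eq_or_ne (deg l) g
    · rw [hR.basis.proj_apply_of_mem hyl, hR.basis.proj_apply_of_mem (hT _ _ hyl)]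
    · rw [hR.basis.proj_apply_of_mem_of_ne hyl hg,
        hR.basis.proj_apply_of_mem_of_ne (hT _ _ hyl) hg, map_zero]
  have hle : gradedMulAlgebra y deg ≤ Subalgebra.centralizer E {T} := by
    refine Algebra.adjoin_le ?_
    rintro _ ((⟨v, rfl⟩ | ⟨v, rfl⟩) | ⟨g, rfl⟩) _ rfl
    · exact LinearMap.ext fun w => congr($hL v w)
    · exact LinearMap.ext fun w => congr($hR' w v)
    · exact (hproj g).symm
  have hcenter : T ∈ Set.center (End E V) := Semigroup.mem_center_iff.2 fun S =>
    (hle (hR.gradedMulAlgebra_eq_top ▸ Algebra.mem_top) T rfl).symm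
  obtain ⟨c, _, rfl⟩ := Module.End.mem_center_iff.1 hcenter
  exact ⟨c, fun v => rfl⟩

variable {F E G A V I : Type*} [Field F] [Field E] [Algebra F E]
  [NonUnitalNonAssocRing A] [Module F A]
  [NonUnitalNonAssocRing V] [Module F V] [Module E V] [IsScalarTower F E V]

theorem exists_algHom_apply_eq_smul (i : A →ₗ[F] V) (hi : i ≠ 0) (C : Subalgebra F (End F A))
    (hC : ∀ s ∈ C, ∃ c : E, ∀ a, i (s a) = c • i a) :
    ∃ φ : C →ₐ[F] E, ∀ (s : C) a, i (s.1 a) = φ s • i a := by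
  obtain ⟨a₀, h₀⟩ := DFunLike.ne_iff.1 hi
  choose f hf using fun s : C => hC s.1 s.2
  have huniq {c c' : E} (h : c • i a₀ = c' • i a₀) : c = c' := smul_left_injective E h₀ h
  refine ⟨{ toFun := f
            map_one' := huniq ?_
            map_mul' := fun s t => huniq ?_
            map_zero' := huniq ?_
            map_add' := fun s t => huniq ?_
            commutes' := fun c => huniq ?_ }, hf⟩
  · rw [← hf, one_smul]; rfl
  · rw [mul_smul, ← hf t, ← hf (s * t), ← hf s]; rfl
  · rw [← hf, zero_smul]; exact map_zero i
  · rw [add_smul, ← hf, ← hf, ← hf]; exact map_add i _ _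
  · rw [← hf, algebraMap_smul, ← map_smul]; rfl

variable [IsScalarTower E V V] [SMulCommClass E V V]
  [CommGroup G] {𝒜 : G → Submodule F A} {𝒱 : G → Submodule E V} {i : A →ₙₐ[F] V}
  {y : Basis I E V} {deg : I → G}

/-- An injective homomorphism `i` of graded algebras onto a dense form of the `E`-algebra `V` whose
elements have their coordinates in the fraction field of the ring of scalars of the multiplication
algebra. -/
structure IsGradedForm (𝒜 : G → Submodule F A) (𝒱 : G → Submodule E V) (i : A →ₙₐ[F] V)
    (y : Basis I E V) (deg : I → G) : Prop where
  injective : Function.Injective i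
  mem_iff : ∀ {g : G} {a : A}, a ∈ 𝒜 g ↔ i a ∈ 𝒱 g
  isDenseForm : IsDenseForm 𝒱 (NonUnitalAlgHom.range i) y deg
  exists_mem_formScalars : ∃ c ∈ formScalars E (NonUnitalAlgHom.range i), c ≠ 0
  repr_mem : ∀ a l, y.repr (i a) l ∈ formField E (NonUnitalAlgHom.range i)

namespace IsGradedForm

variable (hi : IsGradedForm 𝒜 𝒱 i y deg)
include hi

theorem exists_common_denominator [Finite I] (v : V)
    (hv : ∀ l, y.repr v l ∈ formField E (NonUnitalAlgHom.range i)) :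
    ∃ p ∈ formScalars E (NonUnitalAlgHom.range i), p ≠ 0 ∧
      ∀ l, y.repr v l * p ∈ formScalars E (NonUnitalAlgHom.range i) :=
  exists_mul_mem_of_mem_adjoin hi.exists_mem_formScalars hv

theorem exists_apply_eq_basis (l : I) : ∃ a, i a = y l :=
  (NonUnitalAlgHom.mem_range i).1 (hi.isDenseForm.basis_mem l)

variable [IsScalarTower F A A] [SMulCommClass F A A]

theorem mem_neutralCentroid {z : End F A} {c : E} (hz : ∀ a, i (z a) = c • i a) :
    z ∈ neutralCentroid 𝒜 := by
  refine ⟨fun m hm => LinearMap.ext fun a => hi.injective ?_, fun g a ha => ?_⟩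
  · obtain ⟨T, -, hT⟩ := exists_mem_formMulAlgebra (E := E) i hm
    rw [Module.End.mul_apply, Module.End.mul_apply, hz, hT, hT, hz, map_smul]
  · rw [hi.mem_iff, hz]
    exact Submodule.smul_mem _ c (hi.mem_iff.1 ha)

theorem exists_mem_neutralCenter {c : E} (hc : c ∈ formScalars E (NonUnitalAlgHom.range i)) :
    ∃ z ∈ neutralCenter 𝒜, ∀ a, i (z a) = c • i a := by
  obtain ⟨z, hz, hzc⟩ := exists_mem_mulAlgebra i (mem_formScalars.1 hc)
  exact ⟨z, ⟨hz, hi.mem_neutralCentroid hzc⟩, hzc⟩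

theorem exists_end_apply_eq [Finite I] {φ : End F A} (hφ : φ ∈ neutralCentroid 𝒜) :
    ∃ T : End E V, ∀ a, T (i a) = i (φ a) := by
  have := Fintype.ofFinite I
  choose b hb using hi.exists_apply_eq_basis
  refine ⟨y.constr E fun l => i (φ (b l)), fun a => ?_⟩
  obtain ⟨p, hp, hp0, hap⟩ := hi.exists_common_denominator (i a) (hi.repr_mem a)
  obtain ⟨z, hz, hzp⟩ := hi.exists_mem_neutralCenter hp
  choose w hw hwa using fun l => hi.exists_mem_neutralCenter (hap l)
  have hza : z a = ∑ l, w l (b l) := hi.injective <| by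
    simp only [hzp, map_sum, hwa, hb, mul_comm _ p, mul_smul, ← Finset.smul_sum, y.sum_repr]
  have hφz {z : End F A} (hz : z ∈ neutralCenter 𝒜) (x : A) : φ (z x) = z (φ x) :=
    congr($(hφ.1 z hz.1) x)
  refine smul_right_injective V hp0 (?_ : p • _ = p • _)
  rw [← hzp, ← hφz hz, hza]
  simp only [Basis.constr_apply_fintype, Basis.equivFun_apply, Finset.smul_sum, smul_smul, map_sum,
    hφz (hw _), hwa, mul_comm p]

theorem exists_eq_smul [Finite I] {φ : End F A} (hφ : φ ∈ neutralCentroid 𝒜) :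
    ∃ c : E, ∀ a, i (φ a) = c • i a := by
  choose b hb using hi.exists_apply_eq_basis
  obtain ⟨T, hT⟩ := hi.exists_end_apply_eq hφ
  have hTy (l : I) : T (y l) = i (φ (b l)) := hb l ▸ hT (b l)
  have hTneutral : IsNeutralMap 𝒱 T := fun g v hv => by
    suffices h : 𝒱 g ≤ (𝒱 g).comap T from h hv
    conv_lhs => rw [hi.isDenseForm.basis g]
    rw [Submodule.span_le]
    rintro _ ⟨l, rfl, rfl⟩
    rw [SetLike.mem_coe, Submodule.mem_comap, hTy, ← hi.mem_iff]
    exact hφ.2 _ _ (hi.mem_iff.2 (hb l ▸ hi.isDenseForm.basis.basis_mem l))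
  have hl (k l : I) : T (y k * y l) = y k * T (y l) := by
    rw [hTy, ← hb k, ← hb l, ← map_mul, hT, neutralCentroid_mul_left hφ, map_mul]
  have hr (k l : I) : T (y k * y l) = T (y k) * y l := by
    rw [hTy, ← hb k, ← hb l, ← map_mul, hT, neutralCentroid_mul_right hφ, map_mul]
  obtain ⟨c, hc⟩ := hi.isDenseForm.exists_eq_smul hTneutral hl hr
  exact ⟨c, fun a => hT a ▸ hc (i a)⟩

end IsGradedForm

end GradedForm

section CentralLocalizationForm

open Module

variable {F E G A V I : Type*} [Field F] [Field E] [Algebra F E] [CommGroup G]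
  [NonUnitalNonAssocRing V] [Module F V] [Module E V] [IsScalarTower F E V]
  [IsScalarTower E V V] [SMulCommClass E V V]

section

variable {𝒱 : G → Submodule E V} {R R' : NonUnitalSubalgebra F V} {y : Basis I E V} {deg : I → G}

theorem formScalars_mono (h : R ≤ R') : formScalars E R ≤ formScalars E R' := by
  suffices hmul : formMulAlgebra E R ≤ formMulAlgebra E R' from
    fun c hc => mem_formScalars.2 (hmul (mem_formScalars.1 hc))
  exact NonUnitalAlgebra.adjoin_mono
    (Set.union_subset_union (Set.image_mono h) (Set.image_mono h))

omit [Algebra F E] [IsScalarTower F E V] in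
theorem IsDenseForm.mono (hR : IsDenseForm 𝒱 R y deg) (h : R ≤ R') : IsDenseForm 𝒱 R' y deg where
  basis := hR.basis
  mul_mem := hR.mul_mem
  basis_mem l := h (hR.basis_mem l)
  mul_ne_zero := hR.mul_ne_zero
  gradedMulAlgebra_eq_top := hR.gradedMulAlgebra_eq_top

theorem IsDenseForm.formField_le (hR : IsDenseForm 𝒱 R y deg) {K : IntermediateField F E}
    (hK : ∀ r ∈ R, ∀ l, y.repr r l ∈ K) : formField E R ≤ K := by
  refine IntermediateField.adjoin_le_iff.2 fun c hc => ?_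
  obtain ⟨l, -⟩ := exists_basis_mul_ne_zero y hR.mul_ne_zero
  have hcl : c • y l ∈ R := apply_mem_of_mem_unitalFormMulAlgebra
    (formMulAlgebra_le_unitalFormMulAlgebra (mem_formScalars.1 hc)) (hR.basis_mem l)
  simpa using hK _ hcl l

end

variable [NonUnitalNonAssocRing A] [Module F A] [IsScalarTower F A A] [SMulCommClass F A A]
  {𝒜 : G → Submodule F A} {𝒱 : G → Submodule E V} {i : A →ₙₐ[F] V}
  {y : Basis I E V} {deg : I → G} [Finite I]

namespace IsGradedForm

variable (hi : IsGradedForm 𝒜 𝒱 i y deg)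

include hi in
theorem exists_centroidHom :
    ∃ φ : neutralCentroid 𝒜 →ₐ[F] E, ∀ (z : neutralCentroid 𝒜) a, i (z.1 a) = φ z • i a := by
  refine exists_algHom_apply_eq_smul (i : A →ₗ[F] V) (fun h => ?_) _ fun _ => hi.exists_eq_smul
  obtain ⟨l, -⟩ := exists_basis_mul_ne_zero y hi.isDenseForm.mul_ne_zero
  obtain ⟨a, ha⟩ := hi.exists_apply_eq_basis l
  exact y.ne_zero l (ha ▸ congr($h a))

/-- The homomorphism through which the neutral component of the graded centroid of a graded form of
an `E`-algebra acts by scalars of `E`. -/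
def centroidHom : neutralCentroid 𝒜 →ₐ[F] E := hi.exists_centroidHom.choose

/-- The restriction of `IsGradedForm.centroidHom` to `Z(M(A))_e`. -/
def centerHom : neutralCenter 𝒜 →ₙₐ[F] E :=
  (hi.centroidHom : neutralCentroid 𝒜 →ₙₐ[F] E).comp
    (NonUnitalSubalgebra.inclusion (T := (neutralCentroid 𝒜).toNonUnitalSubalgebra)
      fun _ => neutralCenter_le_neutralCentroid)

/-- The restriction of `IsGradedForm.centroidHom` to `F + Z(M(A))_e`. -/
def centralScalarsHom : centralScalars 𝒜 →ₐ[F] E :=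
  hi.centroidHom.comp (Subalgebra.inclusion (centralScalars_le_neutralCentroid 𝒜))

theorem apply_eq_centroidHom_smul (z : neutralCentroid 𝒜) (a : A) :
    i (z.1 a) = hi.centroidHom z • i a :=
  hi.exists_centroidHom.choose_spec z a

theorem apply_eq_centerHom_smul (z : neutralCenter 𝒜) (a : A) :
    i (z.1 a) = hi.centerHom z • i a :=
  hi.apply_eq_centroidHom_smul ⟨z, neutralCenter_le_neutralCentroid z.2⟩ a

theorem apply_smul (s : centralScalars 𝒜) (a : A) :
    i (s • a) = hi.centralScalarsHom s • i a :=
  hi.apply_eq_centroidHom_smul ⟨s, centralScalars_le_neutralCentroid 𝒜 s.2⟩ a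

theorem centroidHom_eq {z : neutralCentroid 𝒜} {c : E} (hz : ∀ a, i (z.1 a) = c • i a) :
    hi.centroidHom z = c := by
  obtain ⟨l, -⟩ := exists_basis_mul_ne_zero y hi.isDenseForm.mul_ne_zero
  obtain ⟨a, ha⟩ := hi.exists_apply_eq_basis l
  refine smul_left_injective E (y.ne_zero l) ?_
  simp only [← ha, ← hz, hi.apply_eq_centroidHom_smul]

theorem centroidHom_injective : Function.Injective hi.centroidHom :=
  fun z z' h => Subtype.ext <| LinearMap.ext fun a => hi.injective <| by
    rw [hi.apply_eq_centroidHom_smul, hi.apply_eq_centroidHom_smul, h]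

theorem centerHom_injective : Function.Injective hi.centerHom :=
  fun _ _ h => Subtype.ext congr(($(hi.centroidHom_injective h)).1)

theorem centroidHom_mem_formField (z : neutralCentroid 𝒜) :
    hi.centroidHom z ∈ formField E (NonUnitalAlgHom.range i) := by
  obtain ⟨l, -⟩ := exists_basis_mul_ne_zero y hi.isDenseForm.mul_ne_zero
  obtain ⟨a, ha⟩ := hi.exists_apply_eq_basis l
  have h := hi.repr_mem (z.1 a) l
  simpa [hi.apply_eq_centroidHom_smul, ha] using h

theorem exists_centerHom_eq {c : E} (hc : c ∈ formScalars E (NonUnitalAlgHom.range i)) :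
    ∃ z, hi.centerHom z = c := by
  obtain ⟨z, hz, hzc⟩ := hi.exists_mem_neutralCenter hc
  exact ⟨⟨z, hz⟩, hi.centroidHom_eq hzc⟩

theorem centralScalarsHom_ne_zero (s : denominators 𝒜) : hi.centralScalarsHom s ≠ 0 := by
  have hle : denominators 𝒜 ≤ (nonZeroDivisors E).comap hi.centralScalarsHom := by
    refine Submonoid.closure_le.2 fun s hs => mem_nonZeroDivisors_of_ne_zero fun h => hs.2 ?_
    exact Subtype.ext congr(($(hi.centroidHom_injective (h.trans (map_zero _).symm))).1)
  exact nonZeroDivisors.ne_zero (hle s.2)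

/-- The underlying map of `IsGradedForm.locEmbedding`. -/
def locMap (x : CentralLocalization 𝒜) : V :=
  LocalizedModule.liftOn x
      (fun p : A × denominators 𝒜 => (hi.centralScalarsHom p.2)⁻¹ • i p.1) <| by
    rintro ⟨a, s⟩ ⟨b, t⟩ ⟨u, h⟩
    have h' := congrArg i h
    simp only [Submonoid.smul_def, hi.apply_smul] at h'
    rw [inv_smul_eq_iff₀ (hi.centralScalarsHom_ne_zero s), smul_comm,
      eq_inv_smul_iff₀ (hi.centralScalarsHom_ne_zero t)]
    exact smul_right_injective V (hi.centralScalarsHom_ne_zero u) h'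

theorem locMap_mk (a : A) (s : denominators 𝒜) :
    hi.locMap (AlgLocalization.mk a s) = (hi.centralScalarsHom s)⁻¹ • i a :=
  rfl

/-- The extension `a / s ↦ s⁻¹ • i a` of a graded form to the central localization. -/
def locEmbedding : CentralLocalization 𝒜 →ₙₐ[F] V where
  toFun := hi.locMap
  map_smul' c x := by
    induction x using AlgLocalization.ind with | _ a s
    rw [AlgLocalization.smul_mk, locMap_mk, locMap_mk, map_smul, smul_comm]
    rfl
  map_zero' := by
    rw [← AlgLocalization.zero_mk 1, locMap_mk, map_zero, smul_zero]
  map_add' x x' := by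
    induction x using AlgLocalization.ind with | _ a s
    induction x' using AlgLocalization.ind with | _ b t
    have hs := hi.centralScalarsHom_ne_zero s
    have ht := hi.centralScalarsHom_ne_zero t
    simp only [AlgLocalization.mk_add_mk, locMap_mk, map_add, Submonoid.smul_def, hi.apply_smul,
      Submonoid.coe_mul, map_mul, smul_add, smul_smul]
    congr 2 <;> field_simp
  map_mul' x x' := by
    induction x using AlgLocalization.ind with | _ a s
    induction x' using AlgLocalization.ind with | _ b t
    rw [AlgLocalization.mk_mul_mk, locMap_mk, locMap_mk, locMap_mk, smul_mul_smul_comm, map_mul,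
      Submonoid.coe_mul, map_mul, mul_inv]

theorem locEmbedding_mk (a : A) (s : denominators 𝒜) :
    hi.locEmbedding (AlgLocalization.mk a s) = (hi.centralScalarsHom s)⁻¹ • i a :=
  rfl

theorem locEmbedding_centralFrac (a : A) (s : neutralCenter 𝒜) (hs : s ≠ 0) :
    hi.locEmbedding (centralFrac 𝒜 a s hs) = (hi.centerHom s)⁻¹ • i a :=
  rfl

theorem locEmbedding_injective : Function.Injective hi.locEmbedding := by
  refine (injective_iff_map_eq_zero _).2 fun x hx => ?_
  induction x using AlgLocalization.ind with | _ a s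
  rw [locEmbedding_mk, smul_eq_zero, inv_eq_zero, or_iff_right (hi.centralScalarsHom_ne_zero s)]
    at hx
  rw [hi.injective (hx.trans (map_zero i).symm), AlgLocalization.zero_mk]

theorem mem_locGrading_iff {g : G} {x : CentralLocalization 𝒜} :
    x ∈ locGrading 𝒜 g ↔ hi.locEmbedding x ∈ 𝒱 g := by
  constructor
  · suffices h : locGrading 𝒜 g ≤ ((𝒱 g).restrictScalars F).comap
      (hi.locEmbedding : CentralLocalization 𝒜 →ₗ[F] V) from fun hx => h hx
    refine Submodule.span_le.2 ?_
    rintro _ ⟨a, ha, s, rfl⟩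
    exact Submodule.smul_mem _ _ (hi.mem_iff.1 ha)
  · induction x using AlgLocalization.ind with | _ a s
    rw [locEmbedding_mk, (𝒱 g).smul_mem_iff (inv_ne_zero (hi.centralScalarsHom_ne_zero s)),
      ← hi.mem_iff]
    exact fun ha => Submodule.subset_span ⟨a, ha, s, rfl⟩

theorem range_le_range_locEmbedding :
    NonUnitalAlgHom.range i ≤ NonUnitalAlgHom.range hi.locEmbedding := by
  rintro _ ⟨a, rfl⟩
  have h : hi.locEmbedding (AlgLocalization.mk a 1) = i a := by
    rw [locEmbedding_mk, OneMemClass.coe_one, map_one, inv_one, one_smul]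
  exact (NonUnitalAlgHom.mem_range _).2 ⟨_, h⟩

theorem repr_locEmbedding_mem (x : CentralLocalization 𝒜) (l : I) :
    y.repr (hi.locEmbedding x) l ∈ formField E (NonUnitalAlgHom.range i) := by
  induction x using AlgLocalization.ind with | _ a s
  rw [locEmbedding_mk, map_smul, Finsupp.smul_apply, smul_eq_mul]
  exact mul_mem (inv_mem (hi.centroidHom_mem_formField _)) (hi.repr_mem a l)

theorem formField_range_locEmbedding :
    formField E (NonUnitalAlgHom.range hi.locEmbedding) =
      formField E (NonUnitalAlgHom.range i) := by
  refine le_antisymm ?_ (IntermediateField.adjoin.mono _ _ _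
    (formScalars_mono hi.range_le_range_locEmbedding))
  refine (hi.isDenseForm.mono hi.range_le_range_locEmbedding).formField_le ?_
  rintro _ ⟨x, rfl⟩ l
  exact hi.repr_locEmbedding_mem x l

end IsGradedForm

end CentralLocalizationForm

section SaturatedForm

open Module

variable {F E G A V I : Type*} [Field F] [Field E] [Algebra F E] [CommGroup G]
  [NonUnitalNonAssocRing A] [Module F A]
  [NonUnitalNonAssocRing V] [Module F V] [Module E V] [IsScalarTower F E V]
  [IsScalarTower E V V] [SMulCommClass E V V]

theorem smul_mem_formMulAlgebra {R : NonUnitalSubalgebra F V} {c : E} (hc : ∀ r ∈ R, c • r ∈ R)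
    {m : End E V} (hm : m ∈ formMulAlgebra E R) : c • m ∈ formMulAlgebra E R := by
  induction hm using NonUnitalAlgebra.adjoin_induction with
  | mem m hm =>
    refine NonUnitalAlgebra.subset_adjoin F ?_
    obtain ⟨r, hr, rfl⟩ | ⟨r, hr, rfl⟩ := hm
    · exact Or.inl ⟨c • r, hc r hr, LinearMap.ext fun v => smul_mul_assoc c r v⟩
    · exact Or.inr ⟨c • r, hc r hr, LinearMap.ext fun v => mul_smul_comm c v r⟩
  | add m m' _ _ ih ih' => exact smul_add c m m' ▸ add_mem ih ih'
  | zero => exact by rw [smul_zero]; exact zero_mem _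
  | mul m m' _ hm' ih _ => exact smul_mul_assoc c m m' ▸ mul_mem ih hm'
  | smul a m _ ih => exact smul_comm c a m ▸ SMulMemClass.smul_mem a ih

theorem mul_mem_map_of_forall_mul_mem {i : A →ₙₐ[F] V} {J : Submodule F A}
    (hJ : ∀ x ∈ J, ∀ a : A, a * x ∈ J ∧ x * a ∈ J) {r v : V} (hr : r ∈ NonUnitalAlgHom.range i)
    (hv : v ∈ J.map (i : A →ₗ[F] V)) :
    r * v ∈ J.map (i : A →ₗ[F] V) ∧ v * r ∈ J.map (i : A →ₗ[F] V) := by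
  obtain ⟨a, rfl⟩ := hr
  obtain ⟨b, hb, rfl⟩ := hv
  exact ⟨⟨a * b, (hJ b hb a).1, map_mul i a b⟩, ⟨b * a, (hJ b hb a).2, map_mul i b a⟩⟩

/-- A graded form `i : A → V` is saturated if its range consists of all elements of `V` whose
coordinates lie in the field generated by the scalars of the multiplication algebra. -/
structure IsSaturatedForm (𝒜 : G → Submodule F A) (𝒱 : G → Submodule E V) (i : A →ₙₐ[F] V)
    (y : Basis I E V) (deg : I → G) : Prop extends IsGradedForm 𝒜 𝒱 i y deg where
  exists_apply_eq : ∀ v, (∀ l, y.repr v l ∈ formField E (NonUnitalAlgHom.range i)) → ∃ a, i a = v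

variable {𝒜 : G → Submodule F A} {𝒱 : G → Submodule E V} {i : A →ₙₐ[F] V}
  {y : Basis I E V} {deg : I → G}

theorem IsGradedForm.isSaturatedForm_locEmbedding [Finite I] [IsScalarTower F A A]
    [SMulCommClass F A A] (hi : IsGradedForm 𝒜 𝒱 i y deg) :
    IsSaturatedForm (locGrading 𝒜) 𝒱 hi.locEmbedding y deg where
  injective := hi.locEmbedding_injective
  mem_iff := hi.mem_locGrading_iff
  isDenseForm := hi.isDenseForm.mono hi.range_le_range_locEmbedding
  exists_mem_formScalars := hi.exists_mem_formScalars.imp fun _ hc =>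
    ⟨formScalars_mono hi.range_le_range_locEmbedding hc.1, hc.2⟩
  repr_mem x l := by
    rw [hi.formField_range_locEmbedding]
    exact hi.repr_locEmbedding_mem x l
  exists_apply_eq v hv := by
    have := Fintype.ofFinite I
    rw [hi.formField_range_locEmbedding] at hv
    obtain ⟨p, hp, hp0, hvp⟩ := hi.exists_common_denominator v hv
    obtain ⟨z, hz⟩ := hi.exists_centerHom_eq hp
    choose w hw using fun l => hi.exists_centerHom_eq (hvp l)
    choose b hb using hi.exists_apply_eq_basis
    have hz0 : z ≠ 0 := by
      rintro rfl
      exact hp0 (hz.symm.trans (map_zero _))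
    refine ⟨centralFrac 𝒜 (∑ l, (w l).1 (b l)) z hz0, ?_⟩
    rw [hi.locEmbedding_centralFrac, hz, inv_smul_eq_iff₀ hp0, map_sum]
    simp only [hi.apply_eq_centerHom_smul, hw, hb, mul_comm _ p, mul_smul, ← Finset.smul_sum,
      y.sum_repr]

theorem IsGradedForm.span_map_eq_top [Finite I] (hi : IsGradedForm 𝒜 𝒱 i y deg)
    {J : Submodule F A}
    (hJ : ∀ x ∈ J, ∀ a : A, a * x ∈ J ∧ x * a ∈ J) {g : G} {x : A} (hxJ : x ∈ J) (hxg : x ∈ 𝒜 g)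
    (hx0 : x ≠ 0) : Submodule.span E (J.map (i : A →ₗ[F] V) : Set V) = ⊤ := by
  refine eq_top_iff.2 (y.span_eq ▸ Submodule.span_le.2 ?_)
  rintro _ ⟨l, rfl⟩
  obtain ⟨m, hm, hml⟩ := hi.isDenseForm.exists_mem_span_homogeneousOps_apply_eq
    (hi.mem_iff.1 hxg) (fun h => hx0 (hi.injective (h.trans (map_zero i).symm)))
    (hi.isDenseForm.basis.basis_mem l)
  suffices h : Submodule.span E (homogeneousOps 𝒱 (NonUnitalAlgHom.range i) _) ≤
      (Submodule.span E (J.map (i : A →ₗ[F] V) : Set V)).comap (LinearMap.applyₗ (i x)) from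
    hml ▸ h hm
  exact Submodule.span_le.2 fun q hq => Submodule.subset_span
    (apply_mem_of_forall_mul_mem (fun _ hr _ => mul_mem_map_of_forall_mul_mem hJ hr) hq.1
      (Submodule.mem_map_of_mem hxJ))

namespace IsSaturatedForm

variable (hi : IsSaturatedForm 𝒜 𝒱 i y deg)
include hi

theorem formField_le_formScalars {c : E} (hc : c ∈ formField E (NonUnitalAlgHom.range i)) :
    c ∈ formScalars E (NonUnitalAlgHom.range i) := by
  obtain ⟨p, hp, hp0⟩ := hi.exists_mem_formScalars
  have hpF : p ∈ formField E (NonUnitalAlgHom.range i) := IntermediateField.subset_adjoin F _ hp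
  have hcp : c = (c * p⁻¹) • p := by rw [smul_eq_mul, inv_mul_cancel_right₀ hp0]
  rw [mem_formScalars, hcp, smul_assoc]
  refine smul_mem_formMulAlgebra ?_ (mem_formScalars.1 hp)
  rintro _ ⟨a, rfl⟩
  refine (NonUnitalAlgHom.mem_range _).2 (hi.exists_apply_eq _ fun l => ?_)
  rw [map_smul]
  exact mul_mem (mul_mem hc (inv_mem hpF)) (hi.repr_mem a l)

theorem isAlgGrading [Finite I] : IsAlgGrading 𝒜 where
  independent g := by
    rw [Submodule.disjoint_def]
    intro x hx hx'
    have hproj : homogeneousProj y deg g (i x) = 0 := by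
      suffices h : ⨆ h, ⨆ _ : h ≠ g, 𝒜 h ≤ LinearMap.ker
          ((homogeneousProj y deg g).restrictScalars F ∘ₗ (i : A →ₗ[F] V)) from h hx'
      exact iSup₂_le fun h hh a ha =>
        hi.isDenseForm.basis.proj_apply_of_mem_of_ne (hi.mem_iff.1 ha) hh
    rw [hi.isDenseForm.basis.proj_apply_of_mem (hi.mem_iff.1 hx)] at hproj
    exact hi.injective (hproj.trans (map_zero i).symm)
  iSup_eq_top := by
    classical
    have := Fintype.ofFinite I
    refine eq_top_iff.2 fun x _ => ?_
    have hsmul (l : I) : ∃ a, i a = y.repr (i x) l • y l := by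
      refine hi.exists_apply_eq _ fun k => ?_
      rw [map_smul, y.repr_self, Finsupp.smul_single, smul_eq_mul, mul_one, Finsupp.single_apply]
      split_ifs
      exacts [hi.repr_mem x l, zero_mem _]
    choose w hw using hsmul
    have hx : x = ∑ l, w l := hi.injective <| by simp only [map_sum, hw, y.sum_repr]
    rw [hx]
    refine sum_mem fun l _ => Submodule.mem_iSup_of_mem (deg l) (hi.mem_iff.2 ?_)
    exact hw l ▸ Submodule.smul_mem _ _ (hi.isDenseForm.basis.basis_mem l)
  mul_mem hx hx' := by
    rw [hi.mem_iff] at hx hx' ⊢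
    exact map_mul i _ _ ▸ hi.isDenseForm.mul_mem hx hx'

theorem mem_of_apply_mem_span [Finite I] {J : Submodule F A}
    (hJ : ∀ x ∈ J, ∀ a : A, a * x ∈ J ∧ x * a ∈ J) {a : A}
    (ha : i a ∈ Submodule.span E (J.map (i : A →ₗ[F] V) : Set V)) : a ∈ J := by
  have := Fintype.ofFinite I
  let K := formField E (NonUnitalAlgHom.range i)
  let N : Submodule K V :=
    { (J.map (i : A →ₗ[F] V)).toAddSubmonoid with
      smul_mem' := fun k v hv => apply_mem_of_forall_mul_mem
        (fun _ hr _ => mul_mem_map_of_forall_mul_mem hJ hr)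
        (formMulAlgebra_le_unitalFormMulAlgebra
          (mem_formScalars.1 (hi.formField_le_formScalars k.2))) hv }
  have hrange (b : A) : i b ∈ Submodule.span K (Set.range y) := by
    rw [← y.sum_repr (i b)]
    exact sum_mem fun l _ => Submodule.smul_mem _ (⟨_, hi.repr_mem b l⟩ : K)
      (Submodule.subset_span ⟨l, rfl⟩)
  have hspan : i a ∈ Submodule.span K (N : Set V) := by
    refine mem_span_of_mem_span_of_mem_span_range y ?_ ha (hrange a)
    rintro _ ⟨b, -, rfl⟩
    exact hrange b
  obtain ⟨b, hb, hba⟩ := N.span_eq ▸ hspan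
  exact hi.injective hba ▸ hb

theorem isGradedSimple [Finite I] : IsGradedSimple 𝒜 where
  grading := hi.isAlgGrading
  mul_ne_zero := by
    obtain ⟨k, l, hkl⟩ := exists_basis_mul_ne_zero y hi.isDenseForm.mul_ne_zero
    obtain ⟨a, ha⟩ := hi.exists_apply_eq_basis k
    obtain ⟨b, hb⟩ := hi.exists_apply_eq_basis l
    refine ⟨a, b, fun hab => hkl ?_⟩
    rw [← ha, ← hb, ← map_mul, hab, map_zero]
  eq_bot_or_eq_top J hJ hhom := by
    refine or_iff_not_imp_left.2 fun hne => ?_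
    rw [hhom, iSup_eq_bot, not_forall] at hne
    obtain ⟨g, hg⟩ := hne
    obtain ⟨x, hx, hx0⟩ := (Submodule.ne_bot_iff _).1 hg
    have hspan := hi.span_map_eq_top hJ hx.1 hx.2 hx0
    exact eq_top_iff.2 fun a _ => hi.mem_of_apply_mem_span hJ (hspan ▸ Submodule.mem_top)

end IsSaturatedForm

end SaturatedForm

section NeutralCentroid

open Module

variable {F E G A V I : Type*} [Field F] [Field E] [Algebra F E] [CommGroup G]
  [NonUnitalNonAssocRing A] [Module F A] [IsScalarTower F A A] [SMulCommClass F A A]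
  [NonUnitalNonAssocRing V] [Module F V] [Module E V] [IsScalarTower F E V]
  [IsScalarTower E V V] [SMulCommClass E V V]
  {𝒜 : G → Submodule F A} {𝒱 : G → Submodule E V} {i : A →ₙₐ[F] V}
  {y : Basis I E V} {deg : I → G} [Finite I]

theorem IsGradedForm.isMulCommutative_neutralCentroid (hi : IsGradedForm 𝒜 𝒱 i y deg) :
    IsMulCommutative (neutralCentroid 𝒜) :=
  ⟨⟨fun z w => hi.centroidHom_injective (by rw [map_mul, map_mul, mul_comm])⟩⟩

namespace IsSaturatedForm

variable (hi : IsSaturatedForm 𝒜 𝒱 i y deg)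

/-- The identification of the neutral component of the graded centroid of a saturated form with
the field generated by the scalars of the multiplication algebra. -/
def centroidEquiv : neutralCentroid 𝒜 ≃ₐ[F] formField E (NonUnitalAlgHom.range i) :=
  AlgEquiv.ofBijective
    (hi.centroidHom.codRestrict (formField E (NonUnitalAlgHom.range i)).toSubalgebra
      hi.centroidHom_mem_formField)
    ⟨fun _ _ h => hi.centroidHom_injective congr(($h).1), fun c => by
      obtain ⟨z, hz⟩ := hi.exists_centerHom_eq (hi.formField_le_formScalars c.2)
      exact ⟨⟨z, neutralCenter_le_neutralCentroid z.2⟩, Subtype.ext hz⟩⟩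

theorem coe_centroidEquiv (k : neutralCentroid 𝒜) :
    (hi.centroidEquiv k : E) = hi.centroidHom k :=
  rfl

theorem centroidHom_centroidEquiv_symm (c : formField E (NonUnitalAlgHom.range i)) :
    hi.centroidHom (hi.centroidEquiv.symm c) = c := by
  rw [← hi.coe_centroidEquiv, AlgEquiv.apply_symm_apply]

include hi in
theorem isField_neutralCentroid [IsMulCommutative (neutralCentroid 𝒜)] :
    IsField (neutralCentroid 𝒜) :=
  hi.centroidEquiv.toMulEquiv.isField (Field.toIsField _)

end IsSaturatedForm

namespace IsGradedForm

variable (hi : IsGradedForm 𝒜 𝒱 i y deg)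

theorem centerHom_mem_formField (z : neutralCenter 𝒜) :
    hi.centerHom z ∈ formField E (NonUnitalAlgHom.range hi.locEmbedding) :=
  hi.formField_range_locEmbedding ▸ hi.centroidHom_mem_formField _

/-- The embedding of `Z(M(A))_e` into the neutral component of the graded centroid of the central
localization, `z ↦ (a / s ↦ z a / s)`. -/
def centerToCentroid : neutralCenter 𝒜 →ₙₐ[F] neutralCentroid (locGrading 𝒜) :=
  (hi.isSaturatedForm_locEmbedding.centroidEquiv.symm :
      _ →ₙₐ[F] neutralCentroid (locGrading 𝒜)).comp
    (NonUnitalAlgHom.codRestrict hi.centerHom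
      (formField E (NonUnitalAlgHom.range hi.locEmbedding)).toSubalgebra.toNonUnitalSubalgebra
      hi.centerHom_mem_formField)

theorem centroidHom_centerToCentroid (z : neutralCenter 𝒜) :
    hi.isSaturatedForm_locEmbedding.centroidHom (hi.centerToCentroid z) = hi.centerHom z :=
  hi.isSaturatedForm_locEmbedding.centroidHom_centroidEquiv_symm _

theorem centerToCentroid_injective : Function.Injective hi.centerToCentroid := fun z w h =>
  hi.centerHom_injective <| by
    rw [← hi.centroidHom_centerToCentroid, h, hi.centroidHom_centerToCentroid]

theorem centerToCentroid_centralFrac (z : neutralCenter 𝒜) (a : A) (s : neutralCenter 𝒜)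
    (hs : s ≠ 0) :
    (hi.centerToCentroid z).1 (centralFrac 𝒜 a s hs) = centralFrac 𝒜 (z.1 a) s hs :=
  hi.locEmbedding_injective <| by
    rw [hi.isSaturatedForm_locEmbedding.apply_eq_centroidHom_smul,
      hi.centroidHom_centerToCentroid, hi.locEmbedding_centralFrac, hi.locEmbedding_centralFrac,
      hi.apply_eq_centerHom_smul, smul_comm]

theorem exists_centerToCentroid_mul_eq (k : neutralCentroid (locGrading 𝒜)) :
    ∃ z s : neutralCenter 𝒜, s ≠ 0 ∧ hi.centerToCentroid s * k = hi.centerToCentroid z := by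
  have hk := hi.isSaturatedForm_locEmbedding.centroidHom_mem_formField k
  rw [formField_range_locEmbedding] at hk
  obtain ⟨p, hp, hp0, hkp⟩ := (mem_adjoin_iff_exists_mul_mem hi.exists_mem_formScalars).1 hk
  obtain ⟨s, rfl⟩ := hi.exists_centerHom_eq hp
  obtain ⟨z, hz⟩ := hi.exists_centerHom_eq hkp
  refine ⟨z, s, fun hs => hp0 (by rw [hs, map_zero]), ?_⟩
  refine hi.isSaturatedForm_locEmbedding.centroidHom_injective ?_
  rw [map_mul, hi.centroidHom_centerToCentroid, hi.centroidHom_centerToCentroid, hz, mul_comm]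

end IsGradedForm

end NeutralCentroid

section CentroidBaseChange

open Module

theorem exists_linearEquiv_tensorProduct {K E M V I : Type*} [CommRing K] [CommRing E] [Algebra K E]
    [AddCommGroup M] [Module K M] [AddCommGroup V] [Module E V] [Finite I] (w : Basis I K M)
    (y : Basis I E V) (j : M →ₛₗ[algebraMap K E] V) (hj : ∀ l, j (w l) = y l) :
    ∃ Φ : E ⊗[K] M ≃ₗ[E] V, ∀ (c : E) (x : M), Φ (c ⊗ₜ x) = c • j x := by
  have := Fintype.ofFinite I
  let Φ := (w.baseChange E).equiv y (Equiv.refl I)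
  have hw (l : I) : Φ (1 ⊗ₜ w l) = j (w l) := by
    have h := (w.baseChange E).equiv_apply l y (Equiv.refl I)
    rwa [Basis.baseChange_apply, Equiv.refl_apply, ← hj] at h
  have hΦ (x : M) : Φ (1 ⊗ₜ x) = j x := by
    rw [← w.sum_repr x, TensorProduct.tmul_sum, map_sum, map_sum]
    refine Finset.sum_congr rfl fun l _ => ?_
    rw [map_smulₛₗ j, ← hw, ← TensorProduct.smul_tmul, Algebra.smul_def, ← smul_eq_mul,
      ← TensorProduct.smul_tmul', map_smul Φ]
  refine ⟨Φ, fun c x => ?_⟩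
  rw [← hΦ, ← map_smul, TensorProduct.smul_tmul', smul_eq_mul, mul_one]

theorem map_mul_of_forall_apply_tmul {K E A V : Type*} [CommRing K] [CommRing E] [Algebra K E]
    [NonUnitalNonAssocRing A] [Module K A] [IsScalarTower K A A] [SMulCommClass K A A]
    [NonUnitalNonAssocRing V] [Module E V] [IsScalarTower E V V] [SMulCommClass E V V]
    {j : A →ₙ* V} {Φ : E ⊗[K] A →ₗ[E] V} (hΦ : ∀ (c : E) (x : A), Φ (c ⊗ₜ x) = c • j x)
    (t t' : E ⊗[K] A) : Φ (t * t') = Φ t * Φ t' := by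
  induction t using TensorProduct.induction_on with
  | zero => rw [zero_mul, map_zero, zero_mul]
  | add s s' hs hs' => rw [add_mul, map_add, hs, hs', map_add, add_mul]
  | tmul c x =>
    induction t' using TensorProduct.induction_on with
    | zero => rw [mul_zero, map_zero, mul_zero]
    | add s s' hs hs' => rw [mul_add, map_add, hs, hs', map_add, mul_add]
    | tmul c' x' =>
      rw [Algebra.TensorProduct.tmul_mul_tmul, hΦ, hΦ, hΦ, map_mul, smul_mul_smul_comm]

variable {F E G A V I : Type*} [Field F] [Field E] [Algebra F E] [CommGroup G]
  [NonUnitalNonAssocRing A] [Module F A] [IsScalarTower F A A] [SMulCommClass F A A]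
  [NonUnitalNonAssocRing V] [Module F V] [Module E V] [IsScalarTower F E V]
  [IsScalarTower E V V] [SMulCommClass E V V]
  {𝒜 : G → Submodule F A} {𝒱 : G → Submodule E V} {i : A →ₙₐ[F] V}
  {y : Basis I E V} {deg : I → G} [Finite I]

omit [Finite I] [IsScalarTower F A A] [SMulCommClass F A A] in
theorem IsGradedForm.map_span_one_tmul {K : Type*} [CommRing K] [Algebra K E] [Module K A]
    {Φ : E ⊗[K] A →ₗ[E] V} (hi : IsGradedForm 𝒜 𝒱 i y deg)
    (hΦ : ∀ (c : E) (x : A), Φ (c ⊗ₜ x) = c • i x) (g : G) :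
    (Submodule.span E {t | ∃ x ∈ 𝒜 g, t = (1 : E) ⊗ₜ[K] x}).map Φ = 𝒱 g := by
  rw [Submodule.map_span]
  refine le_antisymm (Submodule.span_le.2 ?_) ?_
  · rintro _ ⟨_, ⟨x, hx, rfl⟩, rfl⟩
    rw [hΦ, one_smul]
    exact hi.mem_iff.1 hx
  · rw [hi.isDenseForm.basis g]
    refine Submodule.span_mono ?_
    rintro _ ⟨l, hl, rfl⟩
    obtain ⟨x, hx⟩ := hi.exists_apply_eq_basis l
    refine ⟨_, ⟨x, hi.mem_iff.2 ?_, rfl⟩, by rw [hΦ, one_smul, hx]⟩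
    rw [hx, hi.isDenseForm.basis g]
    exact Submodule.subset_span ⟨l, hl, rfl⟩

namespace IsSaturatedForm

variable (hi : IsSaturatedForm 𝒜 𝒱 i y deg) [IsMulCommutative (neutralCentroid 𝒜)]

omit [IsMulCommutative (neutralCentroid 𝒜)] in
include hi in
theorem exists_centroidBasis :
    ∃ w : Basis I (neutralCentroid 𝒜) A, ∀ l, i (w l) = y l := by
  have := Fintype.ofFinite I
  have hsmul (k : neutralCentroid 𝒜) (x : A) : i (k • x) = hi.centroidHom k • i x :=
    hi.apply_eq_centroidHom_smul k x
  choose w hw using hi.exists_apply_eq_basis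
  have hli : LinearIndependent (neutralCentroid 𝒜) w := by
    refine Fintype.linearIndependent_iff.2 fun c hc l => hi.centroidHom_injective ?_
    rw [map_zero]
    refine Fintype.linearIndependent_iff.1 y.linearIndependent
      (fun l => hi.centroidHom (c l)) ?_ l
    simpa only [map_sum, hsmul, hw, map_zero] using congrArg i hc
  have hspan : ⊤ ≤ Submodule.span (neutralCentroid 𝒜) (Set.range w) := fun x _ => by
    let k (l : I) := hi.centroidEquiv.symm ⟨_, hi.repr_mem x l⟩
    have hx : x = ∑ l, k l • w l := hi.injective <| by
      simp only [k, map_sum, hsmul, hi.centroidHom_centroidEquiv_symm, hw, y.sum_repr]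
    rw [hx]
    exact sum_mem fun l _ => Submodule.smul_mem _ _ (Submodule.subset_span ⟨l, rfl⟩)
  exact ⟨Basis.mk hli hspan, fun l => by rw [Basis.mk_apply, hw]⟩

theorem exists_gradedLinearEquiv :
    letI : Algebra (neutralCentroid 𝒜) E := hi.centroidHom.toRingHom.toAlgebra
    ∃ Φ : E ⊗[neutralCentroid 𝒜] A ≃ₗ[E] V, (∀ (c : E) (x : A), Φ (c ⊗ₜ x) = c • i x) ∧
      (∀ t t' : E ⊗[neutralCentroid 𝒜] A, Φ (t * t') = Φ t * Φ t') ∧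
      ∀ g : G, (Submodule.span E {t | ∃ x ∈ 𝒜 g, t = (1 : E) ⊗ₜ[neutralCentroid 𝒜] x}).map
        (Φ : _ →ₗ[E] V) = 𝒱 g := by
  let _ : Algebra (neutralCentroid 𝒜) E := hi.centroidHom.toRingHom.toAlgebra
  let j : A →ₛₗ[algebraMap (neutralCentroid 𝒜) E] V :=
    { (i : A →+ V) with map_smul' := hi.apply_eq_centroidHom_smul }
  obtain ⟨w, hw⟩ := hi.exists_centroidBasis
  obtain ⟨Φ, hΦ⟩ := exists_linearEquiv_tensorProduct w y j hw
  exact ⟨Φ, hΦ,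
    map_mul_of_forall_apply_tmul (K := neutralCentroid 𝒜) (j := (i : A →ₙ* V))
      (Φ := (Φ : _ →ₗ[E] V)) hΦ,
    hi.map_span_one_tmul (K := neutralCentroid 𝒜) (Φ := (Φ : _ →ₗ[E] V)) hΦ⟩

end IsSaturatedForm

end CentroidBaseChange

section Generic

open Module

variable {F G U E : Type*} [Field F] [Field E] {n : G → ℕ} [Algebra (GenericField F n) E]

variable (F E) in
theorem det_genericVar_ne_zero (n : G → ℕ) [Algebra (GenericField F n) E] (g : G) :
    (Matrix.of fun i j => genericVar F E n g i j).det ≠ 0 := by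
  classical
  let P := MvPolynomial (Σ g : G, Fin (n g) × Fin (n g)) F
  let X : Matrix (Fin (n g)) (Fin (n g)) P := Matrix.of fun i j => MvPolynomial.X ⟨g, i, j⟩
  let f : P →+* E := (algebraMap (GenericField F n) E).comp (algebraMap P (GenericField F n))
  have hf : Function.Injective f :=
    (algebraMap (GenericField F n) E).injective.comp (IsFractionRing.injective P _)
  have h1 : (Matrix.of fun i j => genericVar F E n g i j) = f.mapMatrix X := rfl
  rw [h1, ← RingHom.map_det, map_ne_zero_iff f hf]
  intro h0
  let ev : P →+* F := MvPolynomial.eval fun s => if s.2.1 = s.2.2 then 1 else 0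
  have h2 : ev.mapMatrix X = 1 := by
    ext i j
    rw [Matrix.one_apply]
    exact MvPolynomial.eval_X _
  have := congrArg ev h0
  rw [RingHom.map_det, h2, Matrix.det_one, map_zero] at this
  exact one_ne_zero this

variable [NonUnitalNonAssocRing U] [Module F U] [Algebra F E] {𝒰 : G → Submodule F U}

theorem one_tmul_eq_sum_genericElement (u : ∀ g, Basis (Fin (n g)) F (𝒰 g)) (g : G)
    (j : Fin (n g)) : (1 : E) ⊗ₜ[F] (u g j : U) =
      ∑ i, (Matrix.of fun i j => genericVar F E n g i j)⁻¹ j i • genericElement E u g i := by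
  set T := Matrix.of fun i j => genericVar F E n g i j with hT
  have h : T⁻¹ * T = 1 := Matrix.nonsing_inv_mul _ (det_genericVar_ne_zero F E n g).isUnit
  have h1 (i : Fin (n g)) : genericElement E u g i = ∑ l, T i l • ((1 : E) ⊗ₜ[F] (u g l : U)) := by
    simp [genericElement, hT, TensorProduct.smul_tmul']
  simp only [h1, Finset.smul_sum, smul_smul]
  rw [Finset.sum_comm]
  simp only [← Finset.sum_smul, ← Matrix.mul_apply, h]
  simp [Matrix.one_apply]

theorem genericElement_mem_baseChange (u : ∀ g, Basis (Fin (n g)) F (𝒰 g)) (g : G)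
    (i : Fin (n g)) : genericElement E u g i ∈ (𝒰 g).baseChange E :=
  sum_mem fun j _ => Submodule.tmul_mem_baseChange_of_mem _ (u g j).2

variable (E) in
theorem IsHomogeneousBasis.baseChange {I : Type*} {b : Basis I F U} {deg : I → G}
    (hb : IsHomogeneousBasis 𝒰 b deg) :
    IsHomogeneousBasis (fun g => (𝒰 g).baseChange E) (b.baseChange E) deg := by
  intro g
  dsimp only
  rw [hb g, Submodule.baseChange_span, ← Set.image_comp]
  refine congrArg _ (Set.image_congr fun i _ => ?_)
  rw [Basis.baseChange_apply]
  rfl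

variable [CommGroup G]

theorem IsAlgGrading.exists_homogeneousBasis (h𝒰 : IsAlgGrading 𝒰)
    (u : ∀ g, Basis (Fin (n g)) F (𝒰 g)) :
    ∃ b : Basis (Σ g, Fin (n g)) F U, (∀ s, b s = u s.1 s.2) ∧
      IsHomogeneousBasis 𝒰 b Sigma.fst := by
  classical
  have h : DirectSum.IsInternal 𝒰 :=
    (DirectSum.isInternal_submodule_iff_iSupIndep_and_iSup_eq_top _).2
      ⟨h𝒰.independent, h𝒰.iSup_eq_top⟩
  have hb (s : Σ g, Fin (n g)) : h.collectedBasis u s = u s.1 s.2 := by simp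
  refine ⟨h.collectedBasis u, hb, fun g => ?_⟩
  have h1 := congrArg (Submodule.map (𝒰 g).subtype) (u g).span_eq
  rw [Submodule.map_top, Submodule.range_subtype, Submodule.map_span, ← Set.range_comp] at h1
  rw [← h1]
  congr 1
  ext x
  constructor
  · rintro ⟨i, rfl⟩
    exact ⟨⟨g, i⟩, rfl, hb _⟩
  · rintro ⟨⟨g', i⟩, rfl, rfl⟩
    exact ⟨i, (hb _).symm⟩

theorem exists_genericBasis [FiniteDimensional F U] (h𝒰 : IsAlgGrading 𝒰)
    (u : ∀ g, Basis (Fin (n g)) F (𝒰 g)) :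
    ∃ y : Basis (Σ g, Fin (n g)) E (E ⊗[F] U), (∀ s, y s = genericElement E u s.1 s.2) ∧
      IsHomogeneousBasis (fun g => (𝒰 g).baseChange E) y Sigma.fst := by
  classical
  obtain ⟨b, hb, hbh⟩ := h𝒰.exists_homogeneousBasis u
  have := Module.Finite.finite_basis b
  have := Fintype.ofFinite (Σ g, Fin (n g))
  let v (s : Σ g, Fin (n g)) : E ⊗[F] U := genericElement E u s.1 s.2
  have hmem (g : G) (j : Fin (n g)) : (1 : E) ⊗ₜ[F] (u g j : U) ∈
      Submodule.span E (v '' (Sigma.fst ⁻¹' {g})) := by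
    rw [one_tmul_eq_sum_genericElement]
    exact sum_mem fun i _ => Submodule.smul_mem _ _ (Submodule.subset_span ⟨⟨g, i⟩, rfl, rfl⟩)
  have htop : ⊤ ≤ Submodule.span E (Set.range v) := by
    rw [← (b.baseChange E).span_eq, Submodule.span_le]
    rintro _ ⟨s, rfl⟩
    rw [Basis.baseChange_apply, hb]
    exact Submodule.span_mono (Set.image_subset_range _ _) (hmem s.1 s.2)
  let y := basisOfTopLeSpanOfCardEqFinrank v htop
    (Module.finrank_eq_card_basis (b.baseChange E)).symm
  have hy : ⇑y = v := coe_basisOfTopLeSpanOfCardEqFinrank _ _ _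
  refine ⟨y, fun s => congrFun hy s, fun g => ?_⟩
  rw [hy]
  refine le_antisymm ?_ (Submodule.span_le.2 ?_)
  · rw [hbh.baseChange E g, Submodule.span_le]
    rintro _ ⟨s, rfl, rfl⟩
    rw [Basis.baseChange_apply, hb]
    exact hmem s.1 s.2
  · rintro _ ⟨⟨g', i⟩, rfl, rfl⟩
    exact genericElement_mem_baseChange u g' i

variable [IsScalarTower F U U] [SMulCommClass F U U]

theorem mul_mem_baseChange (h𝒰 : IsAlgGrading 𝒰) {g h : G} {v w : E ⊗[F] U}
    (hv : v ∈ (𝒰 g).baseChange E) (hw : w ∈ (𝒰 h).baseChange E) :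
    v * w ∈ (𝒰 (g * h)).baseChange E := by
  rw [Submodule.baseChange_eq_span] at hv hw
  induction hv using Submodule.span_induction with
  | zero => rw [zero_mul]; exact zero_mem _
  | add x z _ _ hx hz => rw [add_mul]; exact add_mem hx hz
  | smul c x _ hx => rw [smul_mul_assoc]; exact Submodule.smul_mem _ c hx
  | mem v hv =>
    obtain ⟨x, hx, rfl⟩ := hv
    induction hw using Submodule.span_induction with
    | zero => rw [mul_zero]; exact zero_mem _
    | add x z _ _ hx hz => rw [mul_add]; exact add_mem hx hz
    | smul c x _ hx => rw [mul_smul_comm]; exact Submodule.smul_mem _ c hx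
    | mem w hw =>
      obtain ⟨x', hx', rfl⟩ := hw
      change ((1 : E) ⊗ₜ[F] x) * ((1 : E) ⊗ₜ[F] x') ∈ _
      rw [Algebra.TensorProduct.tmul_mul_tmul]
      exact Submodule.tmul_mem_baseChange_of_mem _ (h𝒰.mul_mem hx hx')

omit [CommGroup G] in
theorem genericAlgebra_eq_adjoin_range (u : ∀ g, Basis (Fin (n g)) F (𝒰 g))
    {y : Basis (Σ g, Fin (n g)) E (E ⊗[F] U)} (hy : ∀ s, y s = genericElement E u s.1 s.2) :
    genericAlgebra E u = NonUnitalAlgebra.adjoin F (Set.range y) := by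
  rw [genericAlgebra]
  congr 1
  ext v
  exact ⟨fun ⟨g, i, h⟩ => ⟨⟨g, i⟩, (hy _).trans h.symm⟩, fun ⟨s, h⟩ => ⟨s.1, s.2, h ▸ hy s⟩⟩

omit [CommGroup G] in
theorem range_genericAlgIncl (u : ∀ g, Basis (Fin (n g)) F (𝒰 g)) :
    NonUnitalAlgHom.range (GenericAlg.incl E u) = genericAlgebra E u :=
  SetLike.coe_injective Subtype.range_val

variable [FiniteDimensional F U]

theorem isDenseForm_genericAlgebra (hU : IsGradedSimple 𝒰) (hΓ : neutralCentroid 𝒰 = ⊥)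
    (u : ∀ g, Basis (Fin (n g)) F (𝒰 g)) {y : Basis (Σ g, Fin (n g)) E (E ⊗[F] U)}
    (hy : ∀ s, y s = genericElement E u s.1 s.2)
    (hyh : IsHomogeneousBasis (fun g => (𝒰 g).baseChange E) y Sigma.fst) :
    IsDenseForm (fun g => (𝒰 g).baseChange E) (genericAlgebra E u) y Sigma.fst where
  basis := hyh
  mul_mem := mul_mem_baseChange hU.grading
  basis_mem s := NonUnitalAlgebra.subset_adjoin F ⟨s.1, s.2, hy s⟩
  mul_ne_zero := by
    obtain ⟨x, x', hx⟩ := hU.mul_ne_zero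
    refine ⟨(1 : E) ⊗ₜ x, (1 : E) ⊗ₜ x', fun h => hx ?_⟩
    rw [Algebra.TensorProduct.tmul_mul_tmul, one_mul] at h
    exact Module.FaithfullyFlat.tensorProduct_mk_injective (A := F) (B := E) U
      (h.trans (TensorProduct.tmul_zero _ _).symm)
  gradedMulAlgebra_eq_top := by
    obtain ⟨b, -, hb⟩ := hU.grading.exists_homogeneousBasis u
    have := Module.Finite.finite_basis b
    exact gradedMulAlgebra_baseChange_eq_top hb (hU.gradedMulAlgebra_eq_top hΓ hb) hyh

theorem isGradedForm_genericAlg (hU : IsGradedSimple 𝒰) (hΓ : neutralCentroid 𝒰 = ⊥)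
    (u : ∀ g, Basis (Fin (n g)) F (𝒰 g)) {y : Basis (Σ g, Fin (n g)) E (E ⊗[F] U)}
    (hy : ∀ s, y s = genericElement E u s.1 s.2)
    (hyh : IsHomogeneousBasis (fun g => (𝒰 g).baseChange E) y Sigma.fst) :
    IsGradedForm (genericGrading E u) (fun g => (𝒰 g).baseChange E) (GenericAlg.incl E u) y
      Sigma.fst := by
  have := Module.Finite.finite_basis y
  have hR := isDenseForm_genericAlgebra hU hΓ u hy hyh
  have hgen := genericAlgebra_eq_adjoin_range u hy
  rw [← range_genericAlgIncl] at hR hgen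
  exact
    { injective := Subtype.val_injective
      mem_iff := Iff.rfl
      isDenseForm := hR
      exists_mem_formScalars := hR.exists_mem_formScalars_ne_zero hgen
      repr_mem := fun a l => hR.repr_mem_formField hgen ⟨a, rfl⟩ l }

end Generic

set_option maxHeartbeats 400000 in
-- unifying the instances on `GenericLoc E u` in the statement is slow
theorem mainTheorem5 {G F U E : Type*} [CommGroup G] [Field F]
    [NonUnitalNonAssocRing U] [Module F U] [IsScalarTower F U U] [SMulCommClass F U U]
    [FiniteDimensional F U]
    (𝒰 : G → Submodule F U) (hU : IsGradedSimple 𝒰) (hΓ : neutralCentroid 𝒰 = ⊥)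
    (n : G → ℕ) (u : ∀ g, Module.Basis (Fin (n g)) F (𝒰 g))
    [Field E] [Algebra F E] [Algebra (GenericField F n) E]
    [IsScalarTower F (GenericField F n) E] :
    -- (i) `Z_U` embeds in `E`: its elements act on `F_U` through scalars of `E`
    ∃ ι : genericCenter E u →ₙₐ[F] E,
      Function.Injective ι ∧
      (∀ (z : genericCenter E u) (y : GenericAlg E u),
        GenericAlg.incl E u (z.1 y) = ι z • GenericAlg.incl E u y) ∧
      -- (ii) `S⁻¹F_U` is graded simple and its multiplication algebra is PI
      IsGradedSimple (genericLocGrading E u) ∧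
      SatisfiesPI (mulAlgebra F (GenericLoc E u)) ∧
      -- (iii) `K_U` is a field, namely the field of fractions of `Z_U`
      ∃ _ : IsMulCommutative (genericCentroid E u),
        IsField (genericCentroid E u) ∧
        ∃ τ : genericCenter E u →ₙₐ[F] genericCentroid E u,
          Function.Injective τ ∧
          (∀ (z : genericCenter E u) (a : GenericAlg E u) (s : genericCenter E u)
            (hs : s ≠ 0),
            (τ z).1 (centralFrac (genericGrading E u) a s hs) =
              centralFrac (genericGrading E u) (z.1 a) s hs) ∧
          (∀ k : genericCentroid E u, ∃ z s : genericCenter E u, s ≠ 0 ∧ τ s * k = τ z) ∧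
          -- (iv) the induced embeddings `K_U → E` and `S⁻¹F_U → E ⊗ U`, and the isomorphism
          ∃ (κ : genericCentroid E u →ₐ[F] E) (j : GenericLoc E u →ₗ[F] E ⊗[F] U),
            (∀ z : genericCenter E u, κ (τ z) = ι z) ∧
            (∀ (a : GenericAlg E u) (s : genericCenter E u) (hs : s ≠ 0),
              j (centralFrac (genericGrading E u) a s hs) = (ι s)⁻¹ • GenericAlg.incl E u a) ∧
            letI : Algebra (genericCentroid E u) E := κ.toRingHom.toAlgebra
            ∃ Φ : E ⊗[genericCentroid E u] GenericLoc E u ≃ₗ[E] E ⊗[F] U,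
              (∀ (c : E) (x : GenericLoc E u), Φ (c ⊗ₜ x) = c • j x) ∧
              (∀ x y : E ⊗[genericCentroid E u] GenericLoc E u, Φ (x * y) = Φ x * Φ y) ∧
              ∀ g : G, (Submodule.span E {y | ∃ x ∈ genericLocGrading E u g,
                  y = (1 : E) ⊗ₜ[genericCentroid E u] x}).map
                (Φ : _ →ₗ[E] E ⊗[F] U) = (𝒰 g).baseChange E := by
  choose y hy hyh using exists_genericBasis (E := E) hU.grading u
  have := Module.Finite.finite_basis y
  have hi := isGradedForm_genericAlg hU hΓ u hy hyh
  have hloc := hi.isSaturatedForm_locEmbedding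
  have hcomm := hloc.toIsGradedForm.isMulCommutative_neutralCentroid
  exact ⟨hi.centerHom, hi.centerHom_injective, hi.apply_eq_centerHom_smul,
    hloc.isGradedSimple, satisfiesPI_of_injective (E := E) hi.locEmbedding_injective,
    hcomm, hloc.isField_neutralCentroid,
    hi.centerToCentroid, hi.centerToCentroid_injective, hi.centerToCentroid_centralFrac,
    hi.exists_centerToCentroid_mul_eq,
    hloc.centroidHom, (hi.locEmbedding : _ →ₗ[F] _), hi.centroidHom_centerToCentroid,
    hi.locEmbedding_centralFrac, hloc.exists_gradedLinearEquiv⟩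

end
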